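/- Let $P$ be a partition of $n$. For an infinite field $K$ let $J_P$ be the nilpotent $n\times n$ Jordan matrix over $K$ whose Jordan blocks have the parts of $P$ as sizes, and let $\mathcal N_{J_P}(K)$ be the set of nilpotent $n\times n$ matrices over $K$ that commute with $J_P$, with its Zariski topology. The partition formed by the Jordan block sizes of a nilpotent matrix is its Jordan type. There is exactly one partition $Q(P)_K=(q_1(K)\ge q_2(K)\ge\cdots)$ of $n$ (with $q_i(K)=0$ beyond the last part) that is the Jordan type of every element of some Zariski dense open subset of $\mathcal N_{J_P}(K)$. Let $S_P$ be the set of parts of $P$, let $n_i$ be the multiplicity of $i\in S_P$ in $P$, and let $\mathcal D_P=\{(u,i,k): i\in S_P,\ 1\le u\le i,\ 1\le k\le n_i\}$. Let $r_P$ be the least number of almost rectangular partitions (partitions whose parts differ pairwise by at most $1$) whose union, as multisets of parts, is $P$. For a tuple $\mathfrak A=(a_1,\dots,a_s)$ of elements of $S_P$ with $a_i\ge a_{i+1}+2$ for $1\le i<s$, let $U_{\mathfrak A}\subseteq\mathcal D_P$ consist of all $(u,\ell,k)\in\mathcal D_P$ such that either $\ell\in\{a_1,a_1-1,\dots,a_s,a_s-1\}$,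 or $\ell$ is not in this set, $\ell>a_s$, and $u\le m_\ell$ or $u\ge \ell+1-m_\ell$, where $m_\ell=\#\{i: a_i<\ell\}$. Let $u_0=0$, let $u_s$ be the maximum of $|U_{\mathfrak A}|$ over all such $s$-tuples $\mathfrak A$ for $1\le s\le r_P$, and let $\lambda_U(\mathcal D_P)=(\lambda_{1,U}(P),\lambda_{2,U}(P),\dots)$ with $\lambda_{i,U}(P)=u_i-u_{i-1}$ for $1\le i\le r_P$. **Corollary 3.10.** Let $K$ be an infinite field, let $P$ be a partition of $n$, and let $k$ be an integer with $1\le k\le r_P$. If $$\sum_{i=1}^k q_i(\mathbb R)=\sum_{i=1}^k\lambda_{i,U}(P),$$ then $$\sum_{i=1}^k q_i(K)=\sum_{i=1}^k\lambda_{i,U}(P).$$ -/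

import Mathlib

namespace NilpComm

/-- The vertices `(u, i, k)` of the poset `D_P`: `i` runs over the parts of `P` (without
repetition), `1 ≤ u ≤ i`, and `1 ≤ k ≤ n_i`, with `n_i` the multiplicity of `i` in `P`.
They also index the standard basis of the vector space on which the Jordan matrix `J_P` acts. -/
def vertices {n : ℕ} (P : n.Partition) : Finset (ℕ × ℕ × ℕ) :=
  P.parts.toFinset.biUnion fun i =>
    Finset.Icc 1 i ×ˢ ({i} ×ˢ Finset.Icc 1 (P.parts.count i))

theorem mem_vertices {n : ℕ} (P : n.Partition) (u i k : ℕ) :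
    (u, i, k) ∈ vertices P ↔ (1 ≤ u ∧ u ≤ i) ∧ (1 ≤ k ∧ k ≤ P.parts.count i) := by
  simp only [vertices, Finset.mem_biUnion, Multiset.mem_toFinset, Finset.mem_product,
    Finset.mem_Icc, Finset.mem_singleton]
  constructor
  · rintro ⟨j, -, hu, rfl, hk⟩
    exact ⟨hu, hk⟩
  · rintro ⟨hu, hk⟩
    exact ⟨i, Multiset.count_pos.1 (by omega), hu, rfl, hk⟩

/-- The nilpotent Jordan matrix `J_P`: it maps the basis vector `(u, i, k)` to `(u + 1, i, k)`
if `u < i`, and to `0` if `u = i` (matrices act on column vectors). -/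
def jordanMatrix (K : Type*) [Field K] {n : ℕ} (P : n.Partition) :
    Matrix (vertices P) (vertices P) K :=
  Matrix.of fun w v => if w.1 = (v.1.1 + 1, v.1.2) then 1 else 0

/-- `A` has Jordan type `Q` if, in a suitable basis, the matrix of the endomorphism `A` is the
nilpotent Jordan matrix `J_Q`; that is, if `A` is conjugate to `J_Q`. -/
def HasJordanType {K : Type*} [Field K] {m : Type*} [Fintype m] [DecidableEq m] {n : ℕ}
    (A : Matrix m m K) (Q : n.Partition) : Prop :=
  ∃ b : Module.Basis (vertices Q) K (m → K),
    LinearMap.toMatrix b b (Matrix.toLin' A) = jordanMatrix K Q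

/-- The nilpotent commutator `N_B` of `B = J_P`: the nilpotent matrices commuting with `J_P`. -/
def nilpotentCommutator (K : Type*) [Field K] {n : ℕ} (P : n.Partition) :
    Set (Matrix (vertices P) (vertices P) K) :=
  {A | A * jordanMatrix K P = jordanMatrix K P * A ∧ IsNilpotent A}

/-- The Zariski topology on the affine space of `m × m` matrices over `K`: a basis of open sets
is given by the nonvanishing loci of the polynomials in the matrix entries. -/
@[reducible] def zariskiTopology (K : Type*) [Field K] (m : Type*) : TopologicalSpace (Matrix m m K) :=
  TopologicalSpace.generateFrom
    {U | ∃ f : MvPolynomial (m × m) K,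
      U = {A | MvPolynomial.eval (fun e => A e.1 e.2) f ≠ 0}}

open scoped Topology in
/-- `Q` is the generic Jordan type in the nilpotent commutator of `J_P`: there is a dense open
subset `U ∩ N_B` of `N_B`, in the Zariski topology induced on `N_B`, all of whose elements have
Jordan type `Q`. -/
def IsGenericJordanType (K : Type*) [Field K] {n : ℕ} (P Q : n.Partition) : Prop :=
  ∃ U : Set (Matrix (vertices P) (vertices P) K),
    IsOpen[zariskiTopology K (vertices P)] U ∧
    nilpotentCommutator K P ⊆
      closure[zariskiTopology K (vertices P)] (U ∩ nilpotentCommutator K P) ∧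
    ∀ A ∈ U ∩ nilpotentCommutator K P, HasJordanType A Q

/-- The partition `Q(P)` over the field `K`: the generic Jordan type in the nilpotent commutator
of `J_P`. -/
noncomputable def genericJordanType (K : Type*) [Field K] {n : ℕ} (P : n.Partition) :
    n.Partition :=
  Classical.epsilon fun Q => IsGenericJordanType K P Q

/-- The `i`-th part of `Q`, for `i = 1, 2, …`, when the parts are listed in nonincreasing order;
it is `0` if `i` exceeds the number of parts. -/
def part {n : ℕ} (Q : n.Partition) (i : ℕ) : ℕ :=
  (Q.parts.sort (· ≥ ·)).getD (i - 1) 0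

/-- A multiset of parts is almost rectangular if any two of its elements differ by at most one. -/
def IsAlmostRectangular (s : Multiset ℕ) : Prop :=
  ∀ a ∈ s, ∀ b ∈ s, a ≤ b + 1

/-- `r_P`: the least number of almost rectangular subpartitions whose union is `P`. -/
noncomputable def arNumber {n : ℕ} (P : n.Partition) : ℕ :=
  sInf {r | ∃ f : Fin r → Multiset ℕ, (∀ j, IsAlmostRectangular (f j)) ∧ ∑ j, f j = P.parts}

/-- The tuples `(a_1, …, a_s)` of parts of `P` with `a_i ≥ a_{i+1} + 2`, which label the
`s`-`U`-chains of `D_P`. -/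
def IsUChainLabel {n : ℕ} (P : n.Partition) {s : ℕ} (a : Fin s → ℕ) : Prop :=
  (∀ i, a i ∈ P.parts) ∧ ∀ i j, i < j → a j + 2 ≤ a i

/-- The vertices of the `s`-`U`-chain labelled by `(a_1, …, a_s)`: all vertices in the levels
`ℓ ∈ {a_1, a_1 - 1, …, a_s, a_s - 1}` and, in every other level `ℓ` above the smallest `a_i`,
the vertices `(u, ℓ, k)` with `u ≤ #{i | a_i < ℓ}` or `u ≥ ℓ + 1 - #{i | a_i < ℓ}`. -/
def uChain {n : ℕ} (P : n.Partition) {s : ℕ} (a : Fin s → ℕ) : Finset (ℕ × ℕ × ℕ) :=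
  (vertices P).filter fun v =>
    (∃ i, v.2.1 = a i ∨ v.2.1 + 1 = a i) ∨
    ((¬ ∃ i, v.2.1 = a i ∨ v.2.1 + 1 = a i) ∧ (∃ i, a i < v.2.1) ∧
      (v.1 ≤ (Finset.univ.filter fun i => a i < v.2.1).card ∨
        v.2.1 + 1 ≤ v.1 + (Finset.univ.filter fun i => a i < v.2.1).card))

/-- `u_s(D_P)`: the maximal length (number of vertices) of an `s`-`U`-chain of `D_P`.
For `s = 0` the only chain is empty, so the value is `0`. -/
noncomputable def maxUChain {n : ℕ} (P : n.Partition) (s : ℕ) : ℕ :=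
  sSup {c | ∃ a : Fin s → ℕ, IsUChainLabel P a ∧ c = (uChain P a).card}

/-- The `i`-th part `u_i(D_P) - u_{i-1}(D_P)` of `λ_U(D_P)`, for `1 ≤ i ≤ r_P`. -/
noncomputable def lambdaU {n : ℕ} (P : n.Partition) (i : ℕ) : ℤ :=
  (maxUChain P i : ℤ) - (maxUChain P (i - 1) : ℤ)

end NilpComm

/-!
Write `N` for the nilpotent commutator of `J_P` over `K`. A nilpotent matrix `A` of Jordan type `Q`
satisfies `rank (A ^ i) = ∑_{q ∈ Q} (q - i)⁺`. Hence the ranks determine `Q`, and the sum of the `k`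
largest parts of `Q` is the minimum over `i` of `k * i + rank (A ^ i)` (`sum_part_le`,
`exists_sum_part_eq`). So it is enough to control ranks of powers.

*Generic ranks.* The matrices `triMatrix P c` form a linear space of nilpotent matrices in `N`,
with entries which are coordinates of `c` or `0`, and every element of `N` is conjugate to one of
them by an invertible matrix commuting with `J_P` (`exists_conj_triMatrix`). Let `maxRank K P i` be
the largest rank of `triMatrix P c ^ i`. Since minors are polynomials and `K` is infinite, all these
ranks are attained at once, and they are attained on an open subset of `N`. It is dense because any
`g * triMatrix P c * g⁻¹` lies on a line, inside `N`, through such a point. Therefore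
there is exactly one generic Jordan type, and it is characterized by the ranks `maxRank K P i`
(`isGenericJordanType_iff`).

*Comparison with characteristic zero.* The minors of `triMatrix P X ^ i` for the generic matrix are
polynomials over `ℤ`; one that does not vanish over `K` does not vanish over `ℝ`. So
`maxRank K P i ≤ maxRank ℝ P i`, and the sum of the `k` largest parts of `Q(P)_K` is at most that
of `Q(P)_ℝ` (`sum_part_genericJordanType_le`).

*Lower bound.* Over every infinite field, the sum of the `k` largest parts of `Q(P)_K` is at least
the size of each `k`-`U`-chain (`maxUChain_le`). A `U`-chain labelled by `b_0 < b_1 < ⋯ < b_{k-1}`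
is a disjoint union of `k` paths in the poset; the path `c` runs from `(c + 1, L, 1)`, with `L` the
largest part, along the positions `u = c + 1` down to the level `b_c`, then back and forth between
the levels `b_c` and `b_c - 1` (or along `b_c` alone), and then up again along the positions
`u = ℓ - c` of the levels `ℓ`. One takes the matrix in `N` whose coefficients are powers `t ^ wt`
for the moves used by these paths. Conjugation by a diagonal matrix `t ^ φ` turns it into a matrix
`N(t)` with entries `t ^ (wt + φ v - φ w)`, and the potential `φ` can be so chosen that all
exponents are nonnegative and that `N(0)` maps each vertex of a path, except the last one, exactly to
the next vertex of that path. Thus the vertices of the `U`-chain are linearly independent vectors of the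
form `N(0) ^ p * x_j` with `k` vectors `x_j`; the same follows for `N(t)` with some `t ≠ 0`, and
this bounds `k * i + rank (N(t) ^ i)` from below for each `i` (`card_le_of_linearIndependent`).

The potential is determined by its increments from one position to the next, `slope b x ℓ` at
distance `x` from the nearer end of the level `ℓ`. They do not decrease with the level and with the
distance from the end. On the middle part of the chain `c`, on the levels `b_c` and `b_c - 1`, they
are `2 * b_c`, and near the ends they depend on the distance from the end only; the comparison of
these values makes the exponents vanish along the paths and makes them positive for the other moves
that start on the paths.

If the sum of the `k` largest parts of `Q(P)_ℝ` is the maximal size of a `k`-`U`-chain, both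
bounds for `K` agree with it.
-/

namespace NilpComm

/-! ### Jordan bases of nilpotent endomorphisms -/

open Polynomial in
theorem exists_basis_quotient_X_pow (K : Type*) [Field K] (k : ℕ) :
    ∃ B : Module.Basis (Fin k) K (K[X] ⧸ Submodule.span K[X] {(X ^ k : K[X])}),
      ∀ j, B j = Submodule.Quotient.mk (X ^ (j : ℕ)) := by
  have hm : (X ^ k : K[X]).Monic := monic_X_pow k
  let B0 : Module.Basis (Fin (X ^ k : K[X]).natDegree) K (AdjoinRoot (X ^ k : K[X])) :=
    AdjoinRoot.powerBasisAux' hm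
  have h0 : ∀ j, B0 j = AdjoinRoot.mk _ (X ^ (j : ℕ)) := by
    intro j
    have := (AdjoinRoot.powerBasis' hm).basis_eq_pow j
    rw [map_pow]
    exact this
  let e : AdjoinRoot (X ^ k : K[X]) ≃ₗ[K] (K[X] ⧸ Submodule.span K[X] {(X ^ k : K[X])}) :=
    { toFun := fun x => x
      invFun := fun x => x
      left_inv := fun _ => rfl
      right_inv := fun _ => rfl
      map_add' := fun _ _ => rfl
      map_smul' := by
        intro c x
        induction x using AdjoinRoot.induction_on with
        | ih p => rfl }
  refine ⟨(B0.map e).reindex (finCongr (natDegree_X_pow k)), fun j => ?_⟩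
  simp only [Module.Basis.reindex_apply, Module.Basis.map_apply, h0]
  rfl

open Polynomial in
/-- Jordan form of a nilpotent endomorphism `f`: the vectors `b ⟨i, 0⟩, b ⟨i, 1⟩, …` form the `i`-th
Jordan chain. It comes from the structure theorem for torsion modules over `K[X]`, with `X` acting
as `f`. Blocks of size `0` may occur. -/
theorem exists_jordanBasis {K V : Type*} [Field K] [AddCommGroup V] [Module K V]
    [Module.Finite K V] (f : Module.End K V) (hf : IsNilpotent f) :
    ∃ (d : ℕ) (k : Fin d → ℕ) (b : Module.Basis (Σ i, Fin (k i)) K V),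
      ∀ x : Σ i, Fin (k i), f (b x) =
        if h : (x.2 : ℕ) + 1 < k x.1 then b ⟨x.1, ⟨x.2 + 1, h⟩⟩ else 0 := by
  classical
  have htor : Module.IsTorsion' (Module.AEval' f) (Submonoid.powers (X : K[X])) := by
    intro x
    obtain ⟨N, hN⟩ := hf
    refine ⟨⟨X ^ N, (Submonoid.mem_powers_iff _ _).2 ⟨N, rfl⟩⟩, ?_⟩
    obtain ⟨x, rfl⟩ := (Module.AEval'.of f).surjective x
    change (X ^ N : K[X]) • Module.AEval'.of f x = 0
    rw [Module.AEval'.X_pow_smul_of, hN]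
    exact (congrArg _ (LinearMap.zero_apply x)).trans (map_zero _)
  obtain ⟨d, k, ⟨e⟩⟩ := Module.torsion_by_prime_power_decomposition
    (Polynomial.irreducible_X (R := K)) htor
  choose B hB using fun i => exists_basis_quotient_X_pow K (k i)
  let E : V ≃ₗ[K] (∀ i, K[X] ⧸ Submodule.span K[X] {(X ^ k i : K[X])}) :=
    (Module.AEval'.of f).trans ((e.trans (DirectSum.linearEquivFunOnFintype K[X] (Fin d)
      (fun i => K[X] ⧸ Submodule.span K[X] {(X ^ k i : K[X])}))).restrictScalars K)
  have hE : ∀ v, E (f v) = (X : K[X]) • E v := by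
    intro v
    have : Module.AEval'.of f (f v) = (X : K[X]) • Module.AEval'.of f v :=
      (Module.AEval'.X_smul_of f v).symm
    simp only [E, LinearEquiv.trans_apply, this, LinearEquiv.restrictScalars_apply, map_smul]
  refine ⟨d, k, (Pi.basis B).map E.symm, fun x => ?_⟩
  apply E.injective
  rw [hE]
  obtain ⟨i, j⟩ := x
  simp only [Module.Basis.map_apply, LinearEquiv.apply_symm_apply, Pi.basis_apply, hB]
  have key : (X : K[X]) • (Pi.single i (Submodule.Quotient.mk (X ^ (j : ℕ))) :
      ∀ i, K[X] ⧸ Submodule.span K[X] {(X ^ k i : K[X])}) =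
      Pi.single i (Submodule.Quotient.mk (X ^ ((j : ℕ) + 1))) := by
    funext l
    by_cases hl : l = i
    · subst hl
      simp only [Pi.smul_apply, Pi.single_eq_same]
      rw [← Submodule.Quotient.mk_smul, smul_eq_mul, ← pow_succ']
    · simp [Pi.single_eq_of_ne hl]
  rw [key]
  split_ifs with h
  · simp
  · have hk : (j : ℕ) + 1 = k i := by omega
    rw [map_zero, hk, (Submodule.Quotient.mk_eq_zero _).2 (Submodule.mem_span_singleton_self _)]
    simp

/-! ### Existence of Jordan types, and the ranks of the powers -/

theorem card_filter_vertices {n : ℕ} (P : n.Partition) (i : ℕ) :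
    ((vertices P).filter fun w => i < w.1).card = (P.parts.map fun q => q - i).sum := by
  have h : (vertices P).filter (fun w => i < w.1) = P.parts.toFinset.biUnion fun q =>
      Finset.Icc (i + 1) q ×ˢ ({q} ×ˢ Finset.Icc 1 (P.parts.count q)) := by
    ext ⟨u, q, k⟩
    simp only [vertices, Finset.mem_filter, Finset.mem_biUnion, Finset.mem_product,
      Finset.mem_Icc, Finset.mem_singleton]
    constructor
    · rintro ⟨⟨q', h1, h2, h3⟩, h4⟩
      exact ⟨q', h1, by omega, h3⟩
    · rintro ⟨q', h1, h2, h3⟩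
      exact ⟨⟨q', h1, by omega, h3⟩, by omega⟩
  rw [h, Finset.card_biUnion, Finset.sum_multiset_map_count]
  · refine Finset.sum_congr rfl fun q _ => ?_
    simp [mul_comm]
  · intro a _ b _ hab
    refine Finset.disjoint_left.2 ?_
    rintro ⟨u, q, k⟩ h1 h2
    simp only [Finset.mem_product, Finset.mem_singleton] at h1 h2
    exact hab (h1.2.1.symm.trans h2.2.1)

theorem card_vertices {n : ℕ} (P : n.Partition) : (vertices P).card = n := by
  have h := card_filter_vertices P 0
  rw [Finset.filter_true_of_mem] at h
  · simpa [P.parts_sum] using h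
  · rintro ⟨u, q, k⟩ hw
    exact ((mem_vertices P u q k).1 hw).1.1

/-- The numbers of parts `> i` are the differences of the sums `∑ (q - i)`. -/
theorem sum_map_tsub_succ (s : Multiset ℕ) (i : ℕ) :
    (s.map fun q => q - i).sum =
      (s.map fun q => q - (i + 1)).sum + s.countP fun q => i < q := by
  induction s using Multiset.induction with
  | empty => simp
  | cons a s ih =>
    simp only [Multiset.map_cons, Multiset.sum_cons, Multiset.countP_cons, ih]
    split_ifs <;> omega

theorem countP_lt_succ (s : Multiset ℕ) (i : ℕ) :
    (s.countP fun q => i < q) = s.count (i + 1) + s.countP fun q => i + 1 < q := by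
  induction s using Multiset.induction with
  | empty => simp
  | cons a s ih =>
    simp only [Multiset.countP_cons, Multiset.count_cons, ih]
    split_ifs <;> omega

/-- A partition is determined by the numbers `∑ (q - i)`, which are the ranks of the powers of a
nilpotent matrix of that Jordan type. -/
theorem partition_ext_of_sum_tsub {n : ℕ} {Q Q' : n.Partition}
    (h : ∀ i, (Q.parts.map fun q => q - i).sum = (Q'.parts.map fun q => q - i).sum) :
    Q = Q' := by
  have h1 : ∀ i, (Q.parts.countP fun q => i < q) = Q'.parts.countP fun q => i < q := by
    intro i
    have := sum_map_tsub_succ Q.parts i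
    have := sum_map_tsub_succ Q'.parts i
    have := h i
    have := h (i + 1)
    omega
  apply Nat.Partition.ext
  ext i
  rcases i with _ | i
  · rw [Multiset.count_eq_zero_of_notMem, Multiset.count_eq_zero_of_notMem]
    · exact fun h0 => lt_irrefl 0 (Q'.parts_pos h0)
    · exact fun h0 => lt_irrefl 0 (Q.parts_pos h0)
  · have := countP_lt_succ Q.parts i
    have := countP_lt_succ Q'.parts i
    have := h1 i
    have := h1 (i + 1)
    omega

theorem jordanMatrix_pow (K : Type*) [Field K] {n : ℕ} (Q : n.Partition) (i : ℕ) :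
    jordanMatrix K Q ^ i =
      Matrix.of fun w v => if w.1 = (v.1.1 + i, v.1.2) then 1 else 0 := by
  induction i with
  | zero =>
    ext w v
    simp only [pow_zero, Matrix.one_apply, Subtype.ext_iff, Matrix.of_apply, add_zero]
  | succ i ih =>
    ext w v
    rw [pow_succ', Matrix.mul_apply, ih]
    simp only [jordanMatrix, Matrix.of_apply, ite_mul, one_mul, zero_mul]
    obtain ⟨⟨u, q, k⟩, hv⟩ := v
    obtain ⟨⟨u', q', k'⟩, hw⟩ := w
    rw [mem_vertices] at hv hw
    by_cases h : (u', q', k') = (u + (i + 1), q, k)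
    · simp only [Prod.mk.injEq] at h
      obtain ⟨rfl, rfl, rfl⟩ := h
      rw [Finset.sum_eq_single (⟨(u + i, q', k'), by rw [mem_vertices]; omega⟩ : vertices Q)]
      · simp [add_assoc]
      · rintro ⟨⟨a, b, c⟩, hx⟩ _ hne
        simp only [ne_eq, Subtype.mk.injEq, Prod.mk.injEq] at hne ⊢
        rw [if_neg]
        omega
      · simp
    · rw [if_neg h]
      refine Finset.sum_eq_zero ?_
      rintro ⟨⟨a, b, c⟩, hx⟩ _
      simp only [Prod.mk.injEq] at h ⊢
      split_ifs
      · omega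
      all_goals rfl

theorem rank_jordanMatrix_pow (K : Type*) [Field K] {n : ℕ} (Q : n.Partition) (i : ℕ) :
    (jordanMatrix K Q ^ i).rank = (Q.parts.map fun q => q - i).sum := by
  classical
  rw [Matrix.rank_eq_finrank_span_cols]
  have hs : Submodule.span K (Set.range (jordanMatrix K Q ^ i).col) =
      Submodule.span K (Set.range fun w : {w : vertices Q // i < w.1.1} =>
        (Pi.single w.1 1 : vertices Q → K)) := by
    apply le_antisymm
    · rw [Submodule.span_le]
      rintro _ ⟨⟨⟨u, q, k⟩, hv⟩, rfl⟩
      by_cases h : u + i ≤ q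
      · refine Submodule.subset_span
          ⟨⟨⟨(u + i, q, k), ?_⟩, ?_⟩, ?_⟩
        · rw [mem_vertices] at hv ⊢
          omega
        · rw [mem_vertices] at hv
          change i < u + i
          omega
        · ext w
          simp [jordanMatrix_pow, Pi.single_apply, Subtype.ext_iff]
      · have h0 : (jordanMatrix K Q ^ i).col ⟨(u, q, k), hv⟩ = 0 := ?_
        · rw [h0]
          exact Submodule.zero_mem _
        ext ⟨⟨u', q', k'⟩, hw⟩
        rw [mem_vertices] at hw
        simp only [Matrix.col_apply, jordanMatrix_pow, Matrix.of_apply, Prod.mk.injEq,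
          Pi.zero_apply]
        rw [if_neg]
        omega
    · rw [Submodule.span_le]
      rintro _ ⟨⟨⟨⟨u, q, k⟩, hv⟩, h⟩, rfl⟩
      simp only at h
      refine Submodule.subset_span ⟨⟨(u - i, q, k), ?_⟩, ?_⟩
      · rw [mem_vertices] at hv ⊢
        omega
      · ext w
        have : u - i + i = u := by omega
        simp [jordanMatrix_pow, Pi.single_apply, Subtype.ext_iff, this]
  rw [hs, finrank_span_eq_card, ← card_filter_vertices, Fintype.card_subtype]
  · rw [← Finset.card_map (Function.Embedding.subtype _)]
    congr 1
    ext w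
    simp [and_comm]
  · have := (Pi.basisFun K (vertices Q)).linearIndependent.comp
      (fun w : {w : vertices Q // i < w.1.1} => w.1) Subtype.val_injective
    convert this using 1
    ext w
    simp

theorem HasJordanType.rank_pow {K : Type*} [Field K] {m : Type*} [Fintype m] [DecidableEq m]
    {n : ℕ} {A : Matrix m m K} {Q : n.Partition} (h : HasJordanType A Q) (i : ℕ) :
    (A ^ i).rank = (Q.parts.map fun q => q - i).sum := by
  obtain ⟨b, hb⟩ := h
  rw [← rank_jordanMatrix_pow K, ← hb, LinearMap.toMatrix_pow,
    Matrix.rank_eq_finrank_range_toLin _ b b, Matrix.toLin_toMatrix, ← Matrix.toLin'_pow]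
  rfl

theorem exists_hasJordanType {K : Type*} [Field K] {m : Type*} [Fintype m] [DecidableEq m]
    (A : Matrix m m K) (hA : IsNilpotent A) {n : ℕ} (hn : Fintype.card m = n) :
    ∃ Q : n.Partition, HasJordanType A Q := by
  classical
  have hf : IsNilpotent (Matrix.toLin' A) := by
    obtain ⟨N, hN⟩ := hA
    exact ⟨N, by rw [← Matrix.toLin'_pow, hN, map_zero]⟩
  obtain ⟨d, k, b, hb⟩ := exists_jordanBasis (Matrix.toLin' A) hf
  have hcard : ∑ i, k i = n := by
    have := Module.finrank_eq_card_basis b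
    rw [Module.finrank_fintype_fun_eq_card, hn] at this
    simpa using this.symm
  let Q : n.Partition := Nat.Partition.ofSums n (Finset.univ.val.map k) hcard
  -- Blocks of equal size are numbered in the order in which they appear.
  let idx : Fin d → ℕ := fun i => (Finset.univ.filter fun i' => i' ≤ i ∧ k i' = k i).card
  have hidx : ∀ i i', k i = k i' → i < i' → idx i < idx i' := by
    intro i i' h1 h2
    apply Finset.card_lt_card
    rw [Finset.ssubset_iff_of_subset]
    · exact ⟨i', by simp, by simp [h2]⟩
    · intro x
      simp only [Finset.mem_filter, Finset.mem_univ, true_and]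
      rintro ⟨h3, h4⟩
      exact ⟨h3.trans h2.le, h4.trans h1⟩
  have hinj : ∀ i i', k i = k i' → idx i = idx i' → i = i' := by
    intro i i' h1 h2
    rcases lt_trichotomy i i' with h | h | h
    · exact absurd h2 (hidx _ _ h1 h).ne
    · exact h
    · exact absurd h2 (hidx _ _ h1.symm h).ne'
  have hmem : ∀ x : Σ i, Fin (k i), ((x.2 : ℕ) + 1, k x.1, idx x.1) ∈ vertices Q := by
    rintro ⟨i, j⟩
    rw [mem_vertices]
    have hj := j.2
    refine ⟨⟨by omega, by simp only; omega⟩, ?_, ?_⟩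
    · exact Finset.card_pos.2 ⟨i, by simp⟩
    · have hk : k i ≠ 0 := by omega
      rw [show Q.parts.count (k i) = _ from Nat.Partition.count_ofSums_of_ne_zero hcard hk,
        Multiset.count_map]
      refine Finset.card_le_card (t := Finset.univ.filter fun a => k i = k a) ?_
      intro x
      simp only [Finset.mem_filter, Finset.mem_univ, true_and]
      rintro ⟨-, h⟩
      exact h.symm
  let F : (Σ i, Fin (k i)) → vertices Q := fun x => ⟨_, hmem x⟩
  have hF : Function.Bijective F := by
    rw [Fintype.bijective_iff_injective_and_card]
    constructor
    · rintro ⟨i, j⟩ ⟨i', j'⟩ h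
      simp only [F, Subtype.mk.injEq, Prod.mk.injEq] at h
      obtain ⟨h1, h2, h3⟩ := h
      obtain rfl := hinj _ _ h2 h3
      congr 1
      ext
      omega
    · rw [Fintype.card_coe, card_vertices]
      simpa using hcard
  let e := Equiv.ofBijective F hF
  refine ⟨Q, b.reindex e, ?_⟩
  ext w v
  obtain ⟨y, rfl⟩ := e.surjective w
  obtain ⟨x, rfl⟩ := e.surjective v
  rw [LinearMap.toMatrix_apply, Module.Basis.reindex_apply, Equiv.symm_apply_apply, hb,
    Module.Basis.repr_reindex_apply, Equiv.symm_apply_apply]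
  have hiff : ((e y).1 = ((e x).1.1 + 1, (e x).1.2)) ↔
      ∃ h : (x.2 : ℕ) + 1 < k x.1, y = ⟨x.1, ⟨x.2 + 1, h⟩⟩ := by
    obtain ⟨i, j⟩ := x
    obtain ⟨i', j'⟩ := y
    simp only [e, F, Equiv.ofBijective_apply, Prod.mk.injEq]
    constructor
    · rintro ⟨h1, h2, h3⟩
      obtain rfl := hinj _ _ h2 h3
      refine ⟨by omega, ?_⟩
      congr 1
      ext
      simp only
      omega
    · rintro ⟨h, h'⟩
      simp only [Sigma.mk.injEq] at h'
      obtain ⟨rfl, h'⟩ := h'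
      obtain rfl := eq_of_heq h'
      simp
  simp only [jordanMatrix, Matrix.of_apply]
  split_ifs with h1 h2 h2
  · rw [hiff] at h2
    obtain ⟨_, rfl⟩ := h2
    simp
  · rw [hiff] at h2
    rw [Module.Basis.repr_self, Finsupp.single_apply, if_neg]
    rintro rfl
    exact h2 ⟨h1, rfl⟩
  · rw [hiff] at h2
    exact absurd h2.1 h1
  · simp

theorem sum_tsub_eq_zero {n : ℕ} (Q : n.Partition) {i : ℕ} (hi : n ≤ i) :
    (Q.parts.map fun q => q - i).sum = 0 := by
  rw [Multiset.sum_eq_zero_iff]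
  intro x hx
  obtain ⟨q, hq, rfl⟩ := Multiset.mem_map.1 hx
  have := Multiset.le_sum_of_mem hq
  rw [Q.parts_sum] at this
  omega

/-! ### Sums of the largest parts of a partition -/

theorem sum_Icc_part {n : ℕ} (Q : n.Partition) (k : ℕ) :
    ∑ i ∈ Finset.Icc 1 k, part Q i = ((Q.parts.sort (· ≥ ·)).take k).sum := by
  induction k with
  | zero => simp
  | succ k ih =>
    rw [Finset.sum_Icc_succ_top (by omega), ih]
    simp only [part, Nat.add_sub_cancel]
    by_cases h : k < (Q.parts.sort (· ≥ ·)).length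
    · rw [List.sum_take_succ _ _ h, List.getD_eq_getElem _ _ h]
    · rw [List.getD_eq_default _ _ (by omega), List.take_of_length_le (by omega),
        List.take_of_length_le (by omega), add_zero]

theorem sum_map_tsub_eq_sort {n : ℕ} (Q : n.Partition) (i : ℕ) :
    (Q.parts.map fun q => q - i).sum =
      ((Q.parts.sort (· ≥ ·)).map fun q => q - i).sum := by
  conv_lhs => rw [← Multiset.sort_eq Q.parts (· ≥ ·)]
  rw [Multiset.map_coe, Multiset.sum_coe]

theorem sum_take_le (L : List ℕ) (k i : ℕ) :
    (L.take k).sum ≤ k * i + (L.map fun q => q - i).sum := by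
  induction L generalizing k with
  | nil => simp
  | cons a L ih =>
    rcases k with _ | k
    · simp
    · have := ih k
      simp only [List.take_succ_cons, List.sum_cons, List.map_cons, Nat.add_mul, one_mul]
      omega

theorem exists_sum_take_eq (L : List ℕ) (hL : L.Pairwise (· ≥ ·)) (k : ℕ) :
    ∃ i, (L.take k).sum = k * i + (L.map fun q => q - i).sum := by
  suffices h : ∀ i, (∀ q ∈ L.take k, i ≤ q) → (∀ q ∈ L.drop k, q ≤ i) →
      (k ≤ L.length ∨ i = 0) → (L.take k).sum = k * i + (L.map fun q => q - i).sum by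
    refine ⟨L.getD k 0, h _ ?_ ?_ ?_⟩
    · intro q hq
      by_cases hk : k < L.length
      · rw [List.getD_eq_getElem _ _ hk]
        obtain ⟨j, hj, rfl⟩ := List.mem_take_iff_getElem.1 hq
        exact List.pairwise_iff_getElem.1 hL _ _ (by omega) hk (by omega)
      · rw [List.getD_eq_default _ _ (by omega)]
        exact Nat.zero_le _
    · intro q hq
      obtain ⟨j, hj, rfl⟩ := List.mem_drop_iff_getElem.1 hq
      rw [List.getD_eq_getElem _ _ (by omega)]
      rcases Nat.eq_zero_or_pos j with rfl | hj0
      · simp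
      · exact List.pairwise_iff_getElem.1 hL _ _ (by omega) (by omega) (by omega)
    · by_cases hk : k < L.length
      · exact Or.inl hk.le
      · exact Or.inr (List.getD_eq_default _ _ (by omega))
  clear hL
  intro i
  induction L generalizing k with
  | nil =>
    intro _ _ h
    rcases h with h | rfl
    · simp only [List.length_nil, Nat.le_zero] at h
      simp [h]
    · simp
  | cons a L ih =>
    intro h1 h2 h3
    rcases k with _ | k
    · have : ∀ q ∈ (a :: L).map fun q => q - i, q = 0 := by
        intro q hq
        obtain ⟨x, hx, rfl⟩ := List.mem_map.1 hq
        have := h2 x (by simpa using hx)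
        omega
      rw [List.sum_eq_zero this]
      simp
    · have := ih k (fun q hq => h1 q (by simp [hq])) (fun q hq => h2 q (by simpa using hq))
        (by simpa using h3)
      have := h1 a (by simp)
      simp only [List.take_succ_cons, List.sum_cons, List.map_cons, Nat.add_mul, one_mul]
      omega

theorem sum_part_le {n : ℕ} (Q : n.Partition) (k i : ℕ) :
    ∑ j ∈ Finset.Icc 1 k, part Q j ≤ k * i + (Q.parts.map fun q => q - i).sum := by
  rw [sum_Icc_part, sum_map_tsub_eq_sort]
  exact sum_take_le _ _ _

/-- Together with `sum_part_le`, this says that the sum of the `k` largest parts of `Q` is the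
minimum over `i` of `k * i + ∑ (q - i)`. -/
theorem exists_sum_part_eq {n : ℕ} (Q : n.Partition) (k : ℕ) :
    ∃ i, ∑ j ∈ Finset.Icc 1 k, part Q j = k * i + (Q.parts.map fun q => q - i).sum := by
  simp only [sum_Icc_part, sum_map_tsub_eq_sort]
  exact exists_sum_take_eq _ (Multiset.pairwise_sort _ _) _

/-! ### The matrices commuting with the Jordan matrix -/

/-- The index set of a coefficient of a matrix commuting with `J_P`: the coefficient
`((i, k), (i', k'), d)` is the one with which `(u, i, k)` is mapped to `(u + d, i', k')`. -/
abbrev CoeffIndex : Type := (ℕ × ℕ) × (ℕ × ℕ) × ℕ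

/-- The condition on vertices `v` and `w` under which a matrix `triMatrix P c` may map `v` to a
combination in which `w` occurs: the first two inequalities make the matrix commute with `J_P`, the
last condition makes it nilpotent. -/
abbrev TriStep (v w : ℕ × ℕ × ℕ) : Prop :=
  v.1 ≤ w.1 ∧ v.1 + w.2.1 ≤ w.1 + v.2.1 ∧ (w.1 = v.1 → w.2.1 = v.2.1 → v.2.2 < w.2.2)

/-- The matrix commuting with `J_P` with coefficients `c`, all coefficients being dropped that
violate the triangularity condition "`(u, i, k)` is mapped to `(u, i, k')` only if `k < k'`".
These matrices form a linear space of nilpotent matrices. -/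
def triMatrix {R : Type*} [Zero R] {n : ℕ} (P : n.Partition) (c : CoeffIndex → R) :
    Matrix (vertices P) (vertices P) R :=
  Matrix.of fun w v =>
    if TriStep v.1 w.1 then c (v.1.2, w.1.2, w.1.1 - v.1.1) else 0

theorem vertex_bounds {n : ℕ} {P : n.Partition} (v : vertices P) :
    (1 ≤ v.1.1 ∧ v.1.1 ≤ v.1.2.1) ∧ 1 ≤ v.1.2.2 ∧ v.1.2.2 ≤ P.parts.count v.1.2.1 :=
  (mem_vertices P _ _ _).1 v.2

theorem mul_jordanMatrix_pow_apply {K : Type*} [Field K] {n : ℕ} {P : n.Partition}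
    (A : Matrix (vertices P) (vertices P) K) (m : ℕ) (w v v' : vertices P)
    (h : v'.1 = (v.1.1 + m, v.1.2)) : (A * jordanMatrix K P ^ m) w v = A w v' := by
  rw [Matrix.mul_apply, jordanMatrix_pow, Finset.sum_eq_single v']
  · simp [h]
  · intro x _ hx
    rw [Matrix.of_apply, if_neg, mul_zero]
    exact fun h' => hx (Subtype.ext (h'.trans h.symm))
  · simp

theorem mul_jordanMatrix_pow_apply_eq_zero {K : Type*} [Field K] {n : ℕ} {P : n.Partition}
    (A : Matrix (vertices P) (vertices P) K) (m : ℕ) (w v : vertices P)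
    (h : v.1.2.1 < v.1.1 + m) : (A * jordanMatrix K P ^ m) w v = 0 := by
  rw [Matrix.mul_apply, jordanMatrix_pow]
  refine Finset.sum_eq_zero fun x _ => ?_
  rw [Matrix.of_apply, if_neg, mul_zero]
  intro h'
  obtain ⟨⟨a, b, c⟩, hx⟩ := x
  rw [mem_vertices] at hx
  simp only [Prod.ext_iff] at h'
  omega

theorem jordanMatrix_pow_mul_apply {K : Type*} [Field K] {n : ℕ} {P : n.Partition}
    (A : Matrix (vertices P) (vertices P) K) (m : ℕ) (w w' v : vertices P)
    (h : w.1 = (w'.1.1 + m, w'.1.2)) : (jordanMatrix K P ^ m * A) w v = A w' v := by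
  rw [Matrix.mul_apply, jordanMatrix_pow, Finset.sum_eq_single w']
  · simp [h]
  · intro x _ hx
    rw [Matrix.of_apply, if_neg, zero_mul]
    intro h'
    refine hx (Subtype.ext ?_)
    have := h.symm.trans h'
    simp only [Prod.ext_iff] at this ⊢
    omega
  · simp

theorem jordanMatrix_pow_mul_apply_eq_zero {K : Type*} [Field K] {n : ℕ} {P : n.Partition}
    (A : Matrix (vertices P) (vertices P) K) (m : ℕ) (w v : vertices P)
    (h : w.1.1 ≤ m) : (jordanMatrix K P ^ m * A) w v = 0 := by
  rw [Matrix.mul_apply, jordanMatrix_pow]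
  refine Finset.sum_eq_zero fun x _ => ?_
  rw [Matrix.of_apply, if_neg, zero_mul]
  intro h'
  obtain ⟨⟨a, b, c⟩, hx⟩ := x
  rw [mem_vertices] at hx
  simp only [Prod.ext_iff] at h'
  omega

section Centralizer
variable {K : Type*} [Field K] {n : ℕ} {P : n.Partition}
  {A : Matrix (vertices P) (vertices P) K}

/-- A matrix commuting with `J_P` is determined by its columns at the vertices `(1, i, k)`. -/
theorem apply_eq_apply_one (hA : Commute A (jordanMatrix K P)) {u i k u' i' k' : ℕ}
    (hv : (u, i, k) ∈ vertices P) (hw : (u', i', k') ∈ vertices P) (huu : u ≤ u')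
    (hv1 : (1, i, k) ∈ vertices P) (hw1 : (1 + (u' - u), i', k') ∈ vertices P) :
    A ⟨_, hw⟩ ⟨_, hv⟩ = A ⟨_, hw1⟩ ⟨_, hv1⟩ := by
  have h := congrFun (congrFun (hA.pow_right (u - 1)).eq ⟨_, hw⟩) ⟨_, hv1⟩
  rw [mem_vertices] at hv
  rw [mul_jordanMatrix_pow_apply A (u - 1) _ _ ⟨_, mem_vertices P _ _ _ |>.2 hv⟩,
    jordanMatrix_pow_mul_apply A (u - 1) _ ⟨_, hw1⟩] at h
  · exact h
  · simp only [Prod.mk.injEq, and_true]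
    omega
  · simp only [Prod.mk.injEq, and_true]
    omega

/-- A matrix commuting with `J_P` maps a vertex only to vertices that are no closer to the beginning and
no farther from the end of their block. -/
theorem le_of_apply_ne_zero (hA : Commute A (jordanMatrix K P)) {w v : vertices P}
    (h : A w v ≠ 0) : v.1.1 ≤ w.1.1 ∧ v.1.1 + w.1.2.1 ≤ w.1.1 + v.1.2.1 := by
  obtain ⟨⟨u, i, k⟩, hv⟩ := v
  obtain ⟨⟨u', i', k'⟩, hw⟩ := w
  have hv' := (mem_vertices P _ _ _).1 hv
  have hw' := (mem_vertices P _ _ _).1 hw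
  simp only
  constructor
  · by_contra hlt
    have hv1 : (1, i, k) ∈ vertices P := by rw [mem_vertices]; omega
    have e := congrFun (congrFun (hA.pow_right (u - 1)).eq ⟨_, hw⟩) ⟨_, hv1⟩
    rw [mul_jordanMatrix_pow_apply A (u - 1) _ _ ⟨_, hv⟩,
      jordanMatrix_pow_mul_apply_eq_zero A (u - 1)] at e
    · exact h e
    · simp only
      omega
    · simp only [Prod.mk.injEq, and_true]
      omega
  · by_contra hlt
    have hw1 : (u' + (i - u + 1), i', k') ∈ vertices P := by rw [mem_vertices]; omega
    have e := congrFun (congrFun (hA.pow_right (i - u + 1)).eq ⟨_, hw1⟩) ⟨_, hv⟩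
    rw [mul_jordanMatrix_pow_apply_eq_zero A (i - u + 1),
      jordanMatrix_pow_mul_apply A (i - u + 1) _ ⟨_, hw⟩ _ rfl] at e
    · exact h e.symm
    · simp only
      omega

theorem commute_triMatrix (c : CoeffIndex → K) :
    Commute (triMatrix P c) (jordanMatrix K P) := by
  rw [commute_iff_eq]
  ext w v
  have hv := vertex_bounds v
  have hw := vertex_bounds w
  rw [← pow_one (jordanMatrix K P)]
  by_cases h1 : v.1.1 < v.1.2.1
  · have hm : (v.1.1 + 1, v.1.2) ∈ vertices P := by
      rw [mem_vertices P (v.1.1 + 1) v.1.2.1 v.1.2.2]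
      omega
    rw [mul_jordanMatrix_pow_apply _ 1 w v ⟨_, hm⟩ rfl]
    by_cases h2 : 1 < w.1.1
    · have hm' : (w.1.1 - 1, w.1.2) ∈ vertices P := by
        rw [mem_vertices P (w.1.1 - 1) w.1.2.1 w.1.2.2]
        omega
      rw [jordanMatrix_pow_mul_apply _ 1 w ⟨_, hm'⟩ v]
      · simp only [triMatrix, TriStep, Matrix.of_apply]
        congr 1
        · exact propext (by omega)
        · congr 3
          omega
      · ext <;> simp only
        omega
    · rw [jordanMatrix_pow_mul_apply_eq_zero _ 1 w v (by omega)]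
      simp only [triMatrix, TriStep, Matrix.of_apply]
      rw [if_neg]
      omega
  · rw [mul_jordanMatrix_pow_apply_eq_zero _ 1 w v (by omega)]
    by_cases h2 : 1 < w.1.1
    · have hm' : (w.1.1 - 1, w.1.2) ∈ vertices P := by
        rw [mem_vertices P (w.1.1 - 1) w.1.2.1 w.1.2.2]
        omega
      rw [jordanMatrix_pow_mul_apply _ 1 w ⟨_, hm'⟩ v]
      · simp only [triMatrix, TriStep, Matrix.of_apply]
        rw [if_neg]
        omega
      · ext <;> simp only
        omega
    · rw [jordanMatrix_pow_mul_apply_eq_zero _ 1 w v (by omega)]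

theorem isNilpotent_of_strictMono {R m : Type*} [CommRing R] [Fintype m] [DecidableEq m]
    (A : Matrix m m R) (key : m → ℕ) (h : ∀ w v, A w v ≠ 0 → key v < key w) :
    IsNilpotent A := by
  have hp : ∀ (j : ℕ) (w v : m), (A ^ j) w v ≠ 0 → key v + j ≤ key w := by
    intro j
    induction j with
    | zero =>
      intro w v hwv
      rw [pow_zero, Matrix.one_apply] at hwv
      split_ifs at hwv with e
      · simp [e]
      · exact absurd rfl hwv
    | succ j ih =>
      intro w v hwv
      rw [pow_succ, Matrix.mul_apply] at hwv
      obtain ⟨x, _, hx⟩ := Finset.exists_ne_zero_of_sum_ne_zero hwv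
      have h1 := ih w x (left_ne_zero_of_mul hx)
      have h2 := h x v (right_ne_zero_of_mul hx)
      omega
  refine ⟨Finset.univ.sup key + 1, ?_⟩
  ext w v
  by_contra hne
  have h1 := hp _ _ _ hne
  have h2 := Finset.le_sup (f := key) (Finset.mem_univ w)
  omega

/-- A function that increases strictly along the relation `TriStep`. -/
def height {n : ℕ} (P : n.Partition) (v : vertices P) : ℕ :=
  (2 * v.1.1 + (n - v.1.2.1)) * (n + 1) + v.1.2.2

theorem height_lt_of_triStep {v w : vertices P} (h : TriStep v.1 w.1) :
    height P v < height P w := by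
  have hbound : ∀ v : vertices P, v.1.2.1 ≤ n ∧ v.1.2.2 ≤ n := by
    intro v
    have hv := vertex_bounds v
    have hmem : v.1.2.1 ∈ P.parts := Multiset.count_pos.1 (by omega)
    have h1 := Multiset.le_sum_of_mem hmem
    rw [P.parts_sum] at h1
    have h2 : P.parts.card • 1 ≤ P.parts.sum :=
      Multiset.card_nsmul_le_sum fun x hx => P.parts_pos hx
    rw [P.parts_sum] at h2
    have h3 := Multiset.count_le_card v.1.2.1 P.parts
    simp only [smul_eq_mul, mul_one] at h2
    omega
  obtain ⟨h1, h2, h3⟩ := h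
  have hv := hbound v
  have hw := hbound w
  -- `2 * u - i` does not decrease, and if it stays constant, then so do `u` and `i`, whence `k`
  -- increases.
  unfold height
  rcases Nat.lt_or_ge (2 * v.1.1 + (n - v.1.2.1)) (2 * w.1.1 + (n - w.1.2.1)) with hlt | hge
  · have := Nat.mul_le_mul_right (n + 1) (Nat.succ_le_of_lt hlt)
    rw [Nat.succ_mul] at this
    omega
  · have hu : w.1.1 = v.1.1 := by omega
    have hi : w.1.2.1 = v.1.2.1 := by omega
    have := h3 hu hi
    rw [hu, hi]
    omega

theorem isNilpotent_triMatrix (c : CoeffIndex → K) : IsNilpotent (triMatrix P c) := by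
  refine isNilpotent_of_strictMono _ (height P) fun w v h => height_lt_of_triStep ?_
  by_contra hne
  exact h (if_neg hne)

theorem triMatrix_mem_nilpotentCommutator (c : CoeffIndex → K) :
    triMatrix P c ∈ nilpotentCommutator K P :=
  ⟨(commute_triMatrix c).eq, isNilpotent_triMatrix c⟩

theorem one_mem_vertices {u i k : ℕ} (h : (u, i, k) ∈ vertices P) : (1, i, k) ∈ vertices P := by
  rw [mem_vertices] at h ⊢
  omega

open Classical in
/-- A matrix commuting with `J_P` is of the form `triMatrix P c` as soon as its action on the vertices
`(1, i, k)` with fixed `i`, modulo the other vertices, is strictly lower triangular. -/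
theorem exists_eq_triMatrix (hA : Commute A (jordanMatrix K P))
    (htri : ∀ i l k (hl : (1, i, l) ∈ vertices P) (hk : (1, i, k) ∈ vertices P),
      A ⟨_, hl⟩ ⟨_, hk⟩ ≠ 0 → k < l) :
    ∃ c, A = triMatrix P c := by
  refine ⟨fun x => if h : (1, x.1) ∈ vertices P ∧ (1 + x.2.2, x.2.1) ∈ vertices P then
    A ⟨_, h.2⟩ ⟨_, h.1⟩ else 0, ?_⟩
  ext ⟨⟨u', i', k'⟩, hw⟩ ⟨⟨u, i, k⟩, hv⟩
  simp only [triMatrix, TriStep, Matrix.of_apply]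
  split_ifs with h1 h2
  · exact apply_eq_apply_one hA hv hw h1.1 h2.1 h2.2
  · exfalso
    apply h2
    refine ⟨one_mem_vertices hv, ?_⟩
    rw [mem_vertices] at hv hw ⊢
    omega
  · by_contra hne
    obtain ⟨h3, h4⟩ := le_of_apply_ne_zero hA hne
    refine h1 ⟨h3, h4, ?_⟩
    simp only at h3 h4 ⊢
    rintro rfl rfl
    have hw1 : (1 + (u' - u'), i', k') ∈ vertices P := by
      have := one_mem_vertices hw
      simpa using this
    rw [apply_eq_apply_one hA hv hw le_rfl (one_mem_vertices hv) hw1] at hne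
    refine htri i' k' k (one_mem_vertices hw) (one_mem_vertices hv) ?_
    simpa using hne

end Centralizer

/-! ### Conjugation into triangular form -/

/-- A nilpotent matrix is conjugate to a strictly lower triangular one. -/
theorem exists_conj_strictLower {K T : Type*} [Field K] [Fintype T] [LinearOrder T]
    (N : Matrix T T K) (hN : IsNilpotent N) :
    ∃ h h' : Matrix T T K, h * h' = 1 ∧ h' * h = 1 ∧
      ∀ l k, (h' * N * h) l k ≠ 0 → k < l := by
  classical
  obtain ⟨Q, b, hb⟩ := exists_hasJordanType N hN rfl
  -- The lexicographic order on the vertices is such that `u` increases along a Jordan block.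
  let f : vertices Q → ℕ ×ₗ (ℕ ×ₗ ℕ) := fun v => toLex (v.1.1, toLex (v.1.2.1, v.1.2.2))
  have hf : Function.Injective f := by
    rintro ⟨⟨u, i, k⟩, hv⟩ ⟨⟨u', i', k'⟩, hw⟩ h
    simp only [f, EmbeddingLike.apply_eq_iff_eq, Prod.mk.injEq] at h
    simpa using h
  have hcard : Fintype.card (Set.range f) = Fintype.card T := by
    rw [Set.card_range_of_injective hf, Fintype.card_coe, card_vertices]
  let e₁ : T ≃o Set.range f :=
    (Fintype.orderIsoFinOfCardEq T rfl).symm.trans (Fintype.orderIsoFinOfCardEq _ hcard)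
  let e : T ≃ vertices Q := e₁.toEquiv.trans (Equiv.ofInjective f hf).symm
  have he : ∀ t, f (e t) = e₁ t := fun t => Equiv.apply_ofInjective_symm hf (e₁ t)
  let b' : Module.Basis T K (T → K) := b.reindex e.symm
  refine ⟨(Pi.basisFun K T).toMatrix b', b'.toMatrix (Pi.basisFun K T),
    Module.Basis.toMatrix_mul_toMatrix_flip _ _, Module.Basis.toMatrix_mul_toMatrix_flip _ _, ?_⟩
  intro l k hlk
  have h1 : b'.toMatrix (Pi.basisFun K T) * N * (Pi.basisFun K T).toMatrix b' =
      LinearMap.toMatrix b' b' (Matrix.toLin' N) := by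
    rw [← basis_toMatrix_mul_linearMap_toMatrix_mul_basis_toMatrix
      b' (Pi.basisFun K T) b' (Pi.basisFun K T) (Matrix.toLin' N),
      LinearMap.toMatrix_eq_toMatrix', LinearMap.toMatrix'_toLin']
  have h2 : LinearMap.toMatrix b' b' (Matrix.toLin' N) l k = jordanMatrix K Q (e l) (e k) := by
    rw [← hb, LinearMap.toMatrix_apply, LinearMap.toMatrix_apply, Module.Basis.repr_reindex_apply,
      Module.Basis.reindex_apply]
    rfl
  rw [h1, h2, jordanMatrix, Matrix.of_apply] at hlk
  have h3 : (e l).1 = ((e k).1.1 + 1, (e k).1.2) := by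
    by_contra h
    exact hlk (if_neg h)
  rw [← e₁.lt_iff_lt, ← Subtype.coe_lt_coe, ← he, ← he, Prod.Lex.lt_iff]
  refine Or.inl ?_
  simp only [f, h3]
  exact Nat.lt_succ_self _

section Blocks
variable {K : Type*} [Field K] {n : ℕ} (P : n.Partition)

/-- The numbers `1, …, n_i` of the Jordan blocks of size `i`. -/
abbrev BlockIndex (i : ℕ) : Type := Finset.Icc 1 (P.parts.count i)

variable {P}

theorem mem_vertices_of_blockIndex {u i : ℕ} (hu : 1 ≤ u ∧ u ≤ i) (k : BlockIndex P i) :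
    (u, i, k.1) ∈ vertices P :=
  (mem_vertices P _ _ _).2 ⟨hu, Finset.mem_Icc.1 k.2⟩

theorem one_le_of_blockIndex {i : ℕ} (k : BlockIndex P i) : 1 ≤ 1 ∧ 1 ≤ i := by
  have := Finset.mem_Icc.1 k.2
  exact ⟨le_rfl, P.parts_pos (Multiset.count_pos.1 (by omega))⟩

/-- The vertex `(1, i, k)`. -/
def firstVertex {i : ℕ} (k : BlockIndex P i) : vertices P :=
  ⟨(1, i, k.1), mem_vertices_of_blockIndex (one_le_of_blockIndex k) k⟩

theorem firstVertex_injective (i : ℕ) :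
    Function.Injective (firstVertex : BlockIndex P i → vertices P) := by
  intro k l h
  simp only [firstVertex, Subtype.mk.injEq, Prod.mk.injEq, true_and] at h
  exact Subtype.ext h

/-- The action of a matrix commuting with `J_P` on the space spanned by the vertices
`(1, i, k)`, `1 ≤ k ≤ n_i`, modulo the other vertices. -/
def levelBlock (i : ℕ) (A : Matrix (vertices P) (vertices P) K) :
    Matrix (BlockIndex P i) (BlockIndex P i) K :=
  A.submatrix firstVertex firstVertex

theorem levelBlock_mul {A B : Matrix (vertices P) (vertices P) K}
    (hA : Commute A (jordanMatrix K P)) (hB : Commute B (jordanMatrix K P)) (i : ℕ) :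
    levelBlock i (A * B) = levelBlock i A * levelBlock i B := by
  ext l k
  simp only [levelBlock, Matrix.submatrix_apply, Matrix.mul_apply]
  symm
  apply Fintype.sum_of_injective _ (firstVertex_injective i)
  · rintro ⟨⟨u, j, m⟩, hx⟩ hx'
    by_contra hne
    have h1 := le_of_apply_ne_zero hA (left_ne_zero_of_mul hne)
    have h2 := le_of_apply_ne_zero hB (right_ne_zero_of_mul hne)
    simp only [firstVertex] at h1 h2
    have hu : u = 1 := by omega
    have hj : j = i := by omega
    subst hu hj
    exact hx' ⟨⟨m, by rw [mem_vertices] at hx; exact Finset.mem_Icc.2 hx.2⟩, rfl⟩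
  · intro m
    rfl

theorem levelBlock_one (i : ℕ) :
    levelBlock i (1 : Matrix (vertices P) (vertices P) K) = 1 := by
  ext l k
  simp only [levelBlock, Matrix.submatrix_apply, Matrix.one_apply,
    (firstVertex_injective i).eq_iff]

theorem isNilpotent_levelBlock {A : Matrix (vertices P) (vertices P) K}
    (hA : Commute A (jordanMatrix K P)) (hN : IsNilpotent A) (i : ℕ) :
    IsNilpotent (levelBlock i A) := by
  have hp : ∀ m, levelBlock i (A ^ m) = levelBlock i A ^ m := by
    intro m
    induction m with
    | zero => simp [levelBlock_one]
    | succ m ih => rw [pow_succ, pow_succ, levelBlock_mul (hA.pow_left m) hA, ih]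
  obtain ⟨m, hm⟩ := hN
  refine ⟨m, ?_⟩
  rw [← hp, hm]
  ext
  rfl

/-- The matrix commuting with `J_P` that acts on the vertices `(u, i, k)` with fixed `u` and `i`
by a given matrix `h i`. -/
def levelDiag (h : ∀ i, Matrix (BlockIndex P i) (BlockIndex P i) K) :
    Matrix (vertices P) (vertices P) K :=
  Matrix.of fun w v =>
    if e : w.1.1 = v.1.1 ∧ w.1.2.1 = v.1.2.1 then
      h v.1.2.1 ⟨w.1.2.2, by rw [← e.2]; exact Finset.mem_Icc.2 (vertex_bounds w).2⟩
        ⟨v.1.2.2, Finset.mem_Icc.2 (vertex_bounds v).2⟩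
    else 0

theorem levelDiag_one :
    levelDiag (fun _ => 1 : ∀ i, Matrix (BlockIndex P i) (BlockIndex P i) K) = 1 := by
  ext ⟨⟨u', i', k'⟩, hw⟩ ⟨⟨u, i, k⟩, hv⟩
  simp only [levelDiag, Matrix.of_apply, Matrix.one_apply, Subtype.mk.injEq, Prod.mk.injEq]
  split_ifs <;> first | rfl | omega

theorem levelDiag_mul (h h' : ∀ i, Matrix (BlockIndex P i) (BlockIndex P i) K) :
    levelDiag h * levelDiag h' = levelDiag fun i => h i * h' i := by
  ext ⟨⟨u', i', k'⟩, hw⟩ ⟨⟨u, i, k⟩, hv⟩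
  rw [Matrix.mul_apply]
  by_cases e : u' = u ∧ i' = i
  · obtain ⟨rfl, rfl⟩ := e
    have hu := ((mem_vertices _ _ _ _).1 hv).1
    simp only [levelDiag, Matrix.of_apply, and_self, dite_true, Matrix.mul_apply]
    symm
    refine Fintype.sum_of_injective
      (fun m : BlockIndex P i' => (⟨_, mem_vertices_of_blockIndex hu m⟩ : vertices P)) ?_ _ _ ?_ ?_
    · intro m m' hmm
      exact Subtype.ext (congrArg (fun x : vertices P => x.1.2.2) hmm)
    · rintro ⟨⟨a, b, m⟩, hx⟩ hx'
      rw [dif_neg, zero_mul]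
      rintro ⟨rfl, rfl⟩
      exact hx' ⟨⟨m, by rw [mem_vertices] at hx; exact Finset.mem_Icc.2 hx.2⟩, rfl⟩
    · intro m
      rw [dif_pos ⟨rfl, rfl⟩, dif_pos ⟨rfl, rfl⟩]
  · simp only [levelDiag, Matrix.of_apply, dif_neg e]
    refine Finset.sum_eq_zero fun x _ => ?_
    split_ifs with h1 h2
    · omega
    all_goals simp

theorem commute_levelDiag (h : ∀ i, Matrix (BlockIndex P i) (BlockIndex P i) K) :
    Commute (levelDiag h) (jordanMatrix K P) := by
  rw [commute_iff_eq, ← pow_one (jordanMatrix K P)]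
  ext ⟨⟨u', i', k'⟩, hw⟩ ⟨⟨u, i, k⟩, hv⟩
  have hv' := (mem_vertices _ _ _ _).1 hv
  have hw' := (mem_vertices _ _ _ _).1 hw
  by_cases h1 : u < i
  · have hm : (u + 1, i, k) ∈ vertices P := by
      rw [mem_vertices]
      omega
    rw [mul_jordanMatrix_pow_apply _ 1 _ _ ⟨_, hm⟩ rfl]
    by_cases h2 : 1 < u'
    · have hm' : (u' - 1, i', k') ∈ vertices P := by
        rw [mem_vertices]
        omega
      rw [jordanMatrix_pow_mul_apply _ 1 _ ⟨_, hm'⟩ _]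
      · simp only [levelDiag, Matrix.of_apply]
        by_cases e : u' = u + 1 ∧ i' = i
        · rw [dif_pos e, dif_pos (by omega)]
        · rw [dif_neg e, dif_neg (by omega)]
      · simp only [Prod.mk.injEq, and_true]
        omega
    · rw [jordanMatrix_pow_mul_apply_eq_zero _ 1 _ _ (by simp only; omega)]
      simp only [levelDiag, Matrix.of_apply]
      rw [dif_neg]
      omega
  · rw [mul_jordanMatrix_pow_apply_eq_zero _ 1 _ _ (by simp only; omega)]
    by_cases h2 : 1 < u'
    · have hm' : (u' - 1, i', k') ∈ vertices P := by
        rw [mem_vertices]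
        omega
      rw [jordanMatrix_pow_mul_apply _ 1 _ ⟨_, hm'⟩ _]
      · simp only [levelDiag, Matrix.of_apply]
        rw [dif_neg]
        omega
      · simp only [Prod.mk.injEq, and_true]
        omega
    · rw [jordanMatrix_pow_mul_apply_eq_zero _ 1 _ _ (by simp only; omega)]

theorem levelBlock_levelDiag (h : ∀ i, Matrix (BlockIndex P i) (BlockIndex P i) K) (i : ℕ) :
    levelBlock i (levelDiag h) = h i := by
  ext l k
  simp [levelBlock, levelDiag, firstVertex]

/-- Up to conjugation by a matrix commuting with `J_P`, the nilpotent commutator consists of the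
matrices `triMatrix P c`. -/
theorem exists_conj_triMatrix {A : Matrix (vertices P) (vertices P) K}
    (hA : A ∈ nilpotentCommutator K P) :
    ∃ (g g' : Matrix (vertices P) (vertices P) K) (c : CoeffIndex → K),
      g * g' = 1 ∧ g' * g = 1 ∧ Commute g (jordanMatrix K P) ∧ Commute g' (jordanMatrix K P) ∧
      A = g * triMatrix P c * g' := by
  obtain ⟨hcomm, hnil⟩ := hA
  have hc : Commute A (jordanMatrix K P) := hcomm
  choose h h' h1 h2 h3 using fun i =>
    exists_conj_strictLower _ (isNilpotent_levelBlock hc hnil i)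
  have hg := commute_levelDiag h
  have hg' := commute_levelDiag h'
  have hgg' : levelDiag h * levelDiag h' = 1 := by
    rw [levelDiag_mul, ← levelDiag_one]
    congr 1
    exact funext h1
  have hg'g : levelDiag h' * levelDiag h = 1 := by
    rw [levelDiag_mul, ← levelDiag_one]
    congr 1
    exact funext h2
  have hcB : Commute (levelDiag h' * A * levelDiag h) (jordanMatrix K P) :=
    (hg'.mul_left hc).mul_left hg
  obtain ⟨c, hcB'⟩ := exists_eq_triMatrix hcB (by
    intro i l k hl hk hne
    have hl' := Finset.mem_Icc.2 ((mem_vertices _ _ _ _).1 hl).2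
    have hk' := Finset.mem_Icc.2 ((mem_vertices _ _ _ _).1 hk).2
    have e : (levelDiag h' * A * levelDiag h) ⟨_, hl⟩ ⟨_, hk⟩ =
        levelBlock i (levelDiag h' * A * levelDiag h) ⟨l, hl'⟩ ⟨k, hk'⟩ := rfl
    rw [e, levelBlock_mul (hg'.mul_left hc) hg, levelBlock_mul hg' hc, levelBlock_levelDiag,
      levelBlock_levelDiag] at hne
    exact h3 i _ _ hne)
  refine ⟨levelDiag h, levelDiag h', c, hgg', hg'g, hg, hg', ?_⟩
  rw [← hcB']
  simp only [mul_assoc, hgg', mul_one]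
  rw [← mul_assoc, hgg', one_mul]

theorem conj_pow {m : Type*} [Fintype m] [DecidableEq m] {g g' : Matrix m m K}
    (hgg' : g * g' = 1) (hg'g : g' * g = 1) (A : Matrix m m K) (i : ℕ) :
    (g * A * g') ^ i = g * A ^ i * g' := by
  induction i with
  | zero => simp [hgg']
  | succ i ih =>
    rw [pow_succ, ih, pow_succ A i]
    simp only [mul_assoc]
    rw [← mul_assoc g' g, hg'g, one_mul]

theorem rank_conj {m : Type*} [Fintype m] [DecidableEq m] {g g' : Matrix m m K}
    (hgg' : g * g' = 1) (hg'g : g' * g = 1) (A : Matrix m m K) :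
    (g * A * g').rank = A.rank := by
  rw [Matrix.rank_mul_eq_left_of_isUnit_det, Matrix.rank_mul_eq_right_of_isUnit_det]
  · exact (Matrix.isUnit_iff_isUnit_det _).1 (IsUnit.of_mul_eq_one _ hgg')
  · exact (Matrix.isUnit_iff_isUnit_det _).1 (IsUnit.of_mul_eq_one _ hg'g)

theorem conj_mem_nilpotentCommutator {A g g' : Matrix (vertices P) (vertices P) K}
    (hA : A ∈ nilpotentCommutator K P) (hgg' : g * g' = 1) (hg'g : g' * g = 1)
    (hg : Commute g (jordanMatrix K P)) (hg' : Commute g' (jordanMatrix K P)) :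
    g * A * g' ∈ nilpotentCommutator K P := by
  refine ⟨((hg.mul_left hA.1).mul_left hg').eq, ?_⟩
  obtain ⟨m, hm⟩ := hA.2
  exact ⟨m, by rw [conj_pow hgg' hg'g, hm]; simp⟩

end Blocks

/-! ### Minors, the Zariski topology and the generic Jordan type -/

open scoped Topology

theorem exists_linearIndependent_col {K m l : Type*} [Field K] [Fintype m] [Fintype l]
    (A : Matrix m l K) {r : ℕ} (hr : r ≤ A.rank) :
    ∃ cols : Fin r → l, LinearIndependent K (A.submatrix id cols).col := by
  obtain ⟨κ, a, ha, hspan, hli⟩ := exists_linearIndependent' K A.col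
  have : Finite κ := Finite.of_injective a ha
  have := Fintype.ofFinite κ
  rw [Matrix.rank_eq_finrank_span_cols, ← hspan, finrank_span_eq_card hli] at hr
  obtain ⟨e⟩ : Nonempty (Fin r ↪ κ) :=
    Function.Embedding.nonempty_of_card_le (by simpa using hr)
  exact ⟨a ∘ e, hli.comp e e.injective⟩

/-- The rank is the largest size of a nonvanishing minor. -/
theorem le_rank_iff_exists_det_ne_zero {K m l : Type*} [Field K] [Fintype m] [Fintype l]
    (A : Matrix m l K) (r : ℕ) :
    r ≤ A.rank ↔ ∃ (rows : Fin r → m) (cols : Fin r → l), (A.submatrix rows cols).det ≠ 0 := by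
  constructor
  · intro hr
    obtain ⟨cols, hc⟩ := exists_linearIndependent_col A hr
    have h1 : r ≤ ((A.submatrix id cols).transpose).rank := by
      rw [Matrix.rank_transpose, Matrix.rank_eq_finrank_span_cols, finrank_span_eq_card hc]
      simp
    obtain ⟨rows, hrow⟩ := exists_linearIndependent_col _ h1
    refine ⟨rows, cols, ?_⟩
    have h2 : LinearIndependent K (A.submatrix rows cols).row := hrow
    rw [Matrix.linearIndependent_rows_iff_isUnit, Matrix.isUnit_iff_isUnit_det] at h2
    exact h2.ne_zero
  · rintro ⟨rows, cols, h⟩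
    have h1 := Matrix.rank_of_det_ne_zero h
    rw [Fintype.card_fin] at h1
    exact h1.symm.le.trans (Matrix.rank_submatrix_le A rows cols)

theorem triMatrix_map {R S F : Type*} [CommRing R] [CommRing S] [FunLike F R S] [RingHomClass F R S]
    {n : ℕ} (P : n.Partition) (φ : F) (c : CoeffIndex → R) :
    (triMatrix P c).map φ = triMatrix P (fun x => φ (c x)) := by
  ext w v
  simp only [triMatrix, TriStep, Matrix.map_apply, Matrix.of_apply]
  split_ifs <;> simp

/-- A minor of a power of the generic matrix `triMatrix P X`, a polynomial in the coefficients
with integer coefficients. -/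
noncomputable def triMinor {n : ℕ} (P : n.Partition) (i : ℕ) {r : ℕ}
    (rows cols : Fin r → vertices P) : MvPolynomial CoeffIndex ℤ :=
  ((triMatrix P MvPolynomial.X ^ i).submatrix rows cols).det

theorem aeval_triMinor {K : Type*} [Field K] {n : ℕ} (P : n.Partition) (i : ℕ) {r : ℕ}
    (rows cols : Fin r → vertices P) (c : CoeffIndex → K) :
    MvPolynomial.aeval c (triMinor P i rows cols) =
      ((triMatrix P c ^ i).submatrix rows cols).det := by
  let φ : MvPolynomial CoeffIndex ℤ →+* K := (MvPolynomial.aeval c).toRingHom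
  have h : (triMatrix P MvPolynomial.X).map φ = triMatrix P c := by
    rw [triMatrix_map]
    congr 1
    funext x
    simp [φ]
  change φ (triMinor P i rows cols) = _
  rw [triMinor, RingHom.map_det, RingHom.mapMatrix_apply, ← Matrix.submatrix_map, ← h]
  congr 2
  exact (map_pow φ.mapMatrix (triMatrix P MvPolynomial.X) i)

theorem exists_aeval_triMinor_ne_zero {K : Type*} [Field K] [Infinite K] {n : ℕ}
    (P : n.Partition) {ι : Type*} (s : Finset ι) (i r : ι → ℕ)
    (rows cols : ∀ j, Fin (r j) → vertices P)
    (h : ∀ j ∈ s, ∃ c : CoeffIndex → K,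
      MvPolynomial.aeval c (triMinor P (i j) (rows j) (cols j)) ≠ 0) :
    ∃ c : CoeffIndex → K, ∀ j ∈ s,
      MvPolynomial.aeval c (triMinor P (i j) (rows j) (cols j)) ≠ 0 := by
  by_contra! hcon
  have h0 : ∏ j ∈ s, MvPolynomial.map (Int.castRingHom K)
      (triMinor P (i j) (rows j) (cols j)) = 0 := by
    apply MvPolynomial.funext
    intro c
    obtain ⟨j, hj, hj0⟩ := hcon c
    rw [map_zero, map_prod]
    refine Finset.prod_eq_zero hj ?_
    rw [MvPolynomial.eval_map]
    exact hj0
  obtain ⟨j, hj, hj0⟩ := Finset.prod_eq_zero_iff.1 h0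
  obtain ⟨c, hc⟩ := h j hj
  apply hc
  have := congrArg (MvPolynomial.eval c) hj0
  rw [MvPolynomial.eval_map, map_zero] at this
  exact this

/-- The maximal rank of the `i`-th power of a matrix `triMatrix P c`. By `rank_pow_le_maxRank`, it is
also the maximal rank of the `i`-th power of a matrix in the nilpotent commutator of `J_P`. -/
noncomputable def maxRank (K : Type*) [Field K] {n : ℕ} (P : n.Partition) (i : ℕ) : ℕ :=
  sSup (Set.range fun c : CoeffIndex → K => (triMatrix P c ^ i).rank)

section
variable {K : Type*} [Field K] {n : ℕ} {P : n.Partition}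

theorem rank_triMatrix_le (c : CoeffIndex → K) (i : ℕ) :
    (triMatrix P c ^ i).rank ≤ maxRank K P i := by
  refine le_csSup ⟨n, ?_⟩ ⟨c, rfl⟩
  rintro _ ⟨c, rfl⟩
  refine (Matrix.rank_le_card_width _).trans ?_
  rw [Fintype.card_coe, card_vertices]

theorem exists_rank_eq_maxRank (K : Type*) [Field K] (P : n.Partition) (i : ℕ) :
    ∃ c : CoeffIndex → K, (triMatrix P c ^ i).rank = maxRank K P i := by
  have h : maxRank K P i ∈ Set.range fun c : CoeffIndex → K => (triMatrix P c ^ i).rank := by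
    refine Nat.sSup_mem (Set.range_nonempty _) ⟨n, ?_⟩
    rintro _ ⟨c, rfl⟩
    refine (Matrix.rank_le_card_width _).trans ?_
    rw [Fintype.card_coe, card_vertices]
  exact h

theorem exists_aeval_triMinor_maxRank (K : Type*) [Field K] (P : n.Partition) (i : ℕ) :
    ∃ (rows cols : Fin (maxRank K P i) → vertices P) (c : CoeffIndex → K),
      MvPolynomial.aeval c (triMinor P i rows cols) ≠ 0 := by
  obtain ⟨c, hc⟩ := exists_rank_eq_maxRank K P i
  obtain ⟨rows, cols, h⟩ := (le_rank_iff_exists_det_ne_zero _ _).1 hc.ge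
  exact ⟨rows, cols, c, by rwa [aeval_triMinor]⟩

/-- Generic ranks are largest in characteristic zero: a minor of the generic matrix that does not
vanish over `K` is nonzero as a polynomial over `ℤ`. -/
theorem maxRank_le_maxRank_of_charZero (K L : Type*) [Field K] [Field L] [CharZero L]
    (P : n.Partition) (i : ℕ) : maxRank K P i ≤ maxRank L P i := by
  obtain ⟨rows, cols, c, hc⟩ := exists_aeval_triMinor_maxRank K P i
  have h0 : triMinor P i rows cols ≠ 0 := by
    intro h
    rw [h, map_zero] at hc
    exact hc rfl
  obtain ⟨c', hc'⟩ : ∃ c' : CoeffIndex → L,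
      MvPolynomial.aeval c' (triMinor P i rows cols) ≠ 0 := by
    by_contra! hcon
    apply h0
    apply MvPolynomial.map_injective (Int.castRingHom L) (RingHom.injective_int _)
    apply MvPolynomial.funext
    intro c'
    rw [MvPolynomial.eval_map, map_zero, map_zero]
    exact hcon c'
  rw [aeval_triMinor] at hc'
  exact ((le_rank_iff_exists_det_ne_zero _ _).2 ⟨_, _, hc'⟩).trans (rank_triMatrix_le c' i)

theorem rank_pow_eq_zero {A : Matrix (vertices P) (vertices P) K} (hA : IsNilpotent A) {i : ℕ}
    (hi : n ≤ i) : (A ^ i).rank = 0 := by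
  obtain ⟨Q, hQ⟩ := exists_hasJordanType A hA ((Fintype.card_coe _).trans (card_vertices P))
  rw [hQ.rank_pow, sum_tsub_eq_zero Q hi]

/-- The maximal ranks of all powers are attained simultaneously. -/
theorem exists_forall_rank_eq_maxRank (K : Type*) [Field K] [Infinite K] (P : n.Partition) :
    ∃ c : CoeffIndex → K, ∀ i, (triMatrix P c ^ i).rank = maxRank K P i := by
  choose rows cols c hc using exists_aeval_triMinor_maxRank K P
  obtain ⟨c, h⟩ := exists_aeval_triMinor_ne_zero P (Finset.range n) id (maxRank K P) rows cols
    fun j _ => ⟨c j, hc j⟩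
  refine ⟨c, fun i => le_antisymm (rank_triMatrix_le c i) ?_⟩
  by_cases hi : i < n
  · have := h i (Finset.mem_range.2 hi)
    rw [aeval_triMinor] at this
    exact (le_rank_iff_exists_det_ne_zero _ _).2 ⟨_, _, this⟩
  · obtain ⟨c', hc'⟩ := exists_rank_eq_maxRank K P i
    rw [← hc', rank_pow_eq_zero (isNilpotent_triMatrix c') (not_lt.1 hi)]
    exact Nat.zero_le _

theorem rank_pow_le_maxRank {A : Matrix (vertices P) (vertices P) K}
    (hA : A ∈ nilpotentCommutator K P) (i : ℕ) : (A ^ i).rank ≤ maxRank K P i := by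
  obtain ⟨g, g', c, hgg', hg'g, -, -, rfl⟩ := exists_conj_triMatrix hA
  rw [conj_pow hgg' hg'g, rank_conj hgg' hg'g]
  exact rank_triMatrix_le c i

end

section Zariski
variable {K : Type*} [Field K] {m : Type*}

theorem isTopologicalBasis_zariski :
    @TopologicalSpace.IsTopologicalBasis _ (zariskiTopology K m)
      {U | ∃ f : MvPolynomial (m × m) K,
        U = {A | MvPolynomial.eval (fun e => A e.1 e.2) f ≠ 0}} := by
  let _ := zariskiTopology K m
  refine ⟨?_, ?_, rfl⟩
  · rintro _ ⟨f, rfl⟩ _ ⟨g, rfl⟩ A hA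
    refine ⟨_, ⟨f * g, rfl⟩, ?_, ?_⟩
    · simpa using hA
    · intro B hB
      simpa using hB
  · rw [Set.sUnion_eq_univ_iff]
    exact fun A => ⟨_, ⟨1, rfl⟩, by simp⟩

theorem isOpen_eval_ne_zero (f : MvPolynomial (m × m) K) :
    IsOpen[zariskiTopology K m] {A : Matrix m m K | MvPolynomial.eval (fun e => A e.1 e.2) f ≠ 0} :=
  TopologicalSpace.isOpen_generateFrom_of_mem ⟨f, rfl⟩

theorem isOpen_le_rank_pow [Fintype m] [DecidableEq m] (r i : ℕ) :
    IsOpen[zariskiTopology K m] {A : Matrix m m K | r ≤ (A ^ i).rank} := by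
  let _ := zariskiTopology K m
  have h : {A : Matrix m m K | r ≤ (A ^ i).rank} = ⋃ (rows : Fin r → m) (cols : Fin r → m),
      {A | MvPolynomial.eval (fun e => A e.1 e.2)
        ((Matrix.mvPolynomialX m m K ^ i).submatrix rows cols).det ≠ 0} := by
    ext A
    simp only [Set.mem_ofPred_eq, Set.mem_iUnion]
    rw [le_rank_iff_exists_det_ne_zero]
    have e : ∀ rows cols : Fin r → m, MvPolynomial.eval (fun e => A e.1 e.2)
        ((Matrix.mvPolynomialX m m K ^ i).submatrix rows cols).det =
        ((A ^ i).submatrix rows cols).det := by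
      intro rows cols
      rw [RingHom.map_det, RingHom.mapMatrix_apply, ← Matrix.submatrix_map,
        ← RingHom.mapMatrix_apply, map_pow, RingHom.mapMatrix_apply]
      congr 3
      exact Matrix.mvPolynomialX_map_eval₂ (RingHom.id K) A
    simp only [e]
  rw [h]
  exact isOpen_iUnion fun _ => isOpen_iUnion fun _ => isOpen_eval_ne_zero _

theorem eval_aeval_polynomial {σ : Type*} (g : σ → Polynomial K) (f : MvPolynomial σ K) (t : K) :
    Polynomial.eval t (MvPolynomial.aeval g f) =
      MvPolynomial.eval (fun e => Polynomial.eval t (g e)) f := by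
  induction f using MvPolynomial.induction_on with
  | C a => simp
  | add p q hp hq => simp [hp, hq]
  | mul_X p e hp => simp [hp]

/-- Two nonempty open subsets of a line meet. -/
theorem exists_line_inter [Infinite K] {U V : Set (Matrix m m K)}
    (hU : IsOpen[zariskiTopology K m] U) (hV : IsOpen[zariskiTopology K m] V)
    {A B : Matrix m m K} (hA : A ∈ U) (hB : B ∈ V) :
    ∃ t : K, A + t • (B - A) ∈ U ∩ V := by
  let _ := zariskiTopology K m
  obtain ⟨_, ⟨f, rfl⟩, hAf, hfU⟩ := isTopologicalBasis_zariski.exists_subset_of_mem_open hA hU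
  obtain ⟨_, ⟨g, rfl⟩, hBg, hgV⟩ := isTopologicalBasis_zariski.exists_subset_of_mem_open hB hV
  let ℓ : m × m → Polynomial K := fun e =>
    Polynomial.C (A e.1 e.2) + Polynomial.X * Polynomial.C ((B - A) e.1 e.2)
  have hℓ : ∀ (h : MvPolynomial (m × m) K) (t : K),
      Polynomial.eval t (MvPolynomial.aeval ℓ h) =
        MvPolynomial.eval (fun e => (A + t • (B - A)) e.1 e.2) h := by
    intro h t
    rw [eval_aeval_polynomial]
    congr 2
    funext e
    simp [ℓ]
  have hf0 : MvPolynomial.aeval ℓ f ≠ 0 := by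
    intro h0
    have := hℓ f 0
    rw [h0, zero_smul, add_zero, Polynomial.eval_zero] at this
    exact hAf this.symm
  have hg0 : MvPolynomial.aeval ℓ g ≠ 0 := by
    intro h0
    have := hℓ g 1
    rw [h0, one_smul, add_sub_cancel, Polynomial.eval_zero] at this
    exact hBg this.symm
  obtain ⟨t, ht⟩ : ∃ t, Polynomial.eval t (MvPolynomial.aeval ℓ f * MvPolynomial.aeval ℓ g) ≠ 0 := by
    by_contra! hcon
    exact mul_ne_zero hf0 hg0 (Polynomial.funext fun t => by simpa using hcon t)
  rw [Polynomial.eval_mul, hℓ, hℓ] at ht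
  exact ⟨t, hfU (left_ne_zero_of_mul ht), hgV (right_ne_zero_of_mul ht)⟩

end Zariski

section
variable {K : Type*} [Field K] {n : ℕ} {P : n.Partition}

theorem triMatrix_line (c d : CoeffIndex → K) (t : K) :
    triMatrix P c + t • (triMatrix P d - triMatrix P c) = triMatrix P (c + t • (d - c)) := by
  ext w v
  simp only [triMatrix, TriStep, Matrix.add_apply, Matrix.smul_apply, Matrix.sub_apply, Matrix.of_apply]
  split_ifs <;> simp

/-- The generic Jordan type is the one with the maximal ranks of powers. -/
theorem isGenericJordanType_iff [Infinite K] (Q : n.Partition) :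
    IsGenericJordanType K P Q ↔ ∀ i, (Q.parts.map fun q => q - i).sum = maxRank K P i := by
  let _ := zariskiTopology K (vertices P)
  let U : Set (Matrix (vertices P) (vertices P) K) :=
    {A | ∀ i ∈ Finset.range n, maxRank K P i ≤ (A ^ i).rank}
  have hU : IsOpen U := by
    have : U = ⋂ i ∈ Finset.range n, {A | maxRank K P i ≤ (A ^ i).rank} := by
      ext A
      simp [U]
    rw [this]
    exact isOpen_biInter_finset fun i _ => isOpen_le_rank_pow _ _
  have hrank : ∀ A ∈ U ∩ nilpotentCommutator K P, ∀ i, (A ^ i).rank = maxRank K P i := by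
    rintro A ⟨hAU, hA⟩ i
    refine le_antisymm (rank_pow_le_maxRank hA i) ?_
    by_cases hi : i < n
    · exact hAU i (Finset.mem_range.2 hi)
    · obtain ⟨c, hc⟩ := exists_rank_eq_maxRank K P i
      rw [← hc, rank_pow_eq_zero (isNilpotent_triMatrix c) (not_lt.1 hi)]
      exact Nat.zero_le _
  obtain ⟨c₁, hc₁⟩ := exists_forall_rank_eq_maxRank K P
  constructor
  · rintro ⟨V, hV, hdense, htype⟩
    have h1 := hdense (triMatrix_mem_nilpotentCommutator c₁)
    obtain ⟨A, hAU, hAV⟩ := mem_closure_iff.1 h1 U hU fun i _ => (hc₁ i).ge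
    intro i
    rw [← (htype A hAV).rank_pow, hrank A ⟨hAU, hAV.2⟩]
  · intro hQ
    refine ⟨U, hU, ?_, ?_⟩
    · intro A hA
      rw [mem_closure_iff]
      intro V hV hAV
      obtain ⟨g, g', c₀, hgg', hg'g, hg, hg', rfl⟩ := exists_conj_triMatrix hA
      have h1 : g * triMatrix P c₁ * g' ∈ U := by
        intro i _
        rw [conj_pow hgg' hg'g, rank_conj hgg' hg'g, hc₁]
      obtain ⟨t, htV, htU⟩ := exists_line_inter hV hU hAV h1
      refine ⟨_, htV, htU, ?_⟩
      have : g * triMatrix P c₀ * g' + t • (g * triMatrix P c₁ * g' - g * triMatrix P c₀ * g') =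
          g * triMatrix P (c₀ + t • (c₁ - c₀)) * g' := by
        rw [← triMatrix_line]
        simp only [Matrix.mul_add, Matrix.add_mul, Matrix.mul_smul, Matrix.smul_mul,
          Matrix.mul_sub, Matrix.sub_mul]
      rw [this]
      exact conj_mem_nilpotentCommutator (triMatrix_mem_nilpotentCommutator _) hgg' hg'g hg hg'
    · intro A hA
      obtain ⟨Q', hQ'⟩ := exists_hasJordanType A hA.2.2
        ((Fintype.card_coe _).trans (card_vertices P))
      have : Q = Q' := partition_ext_of_sum_tsub fun i => by
        rw [hQ, ← hrank A hA, hQ'.rank_pow]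
      rwa [this]

theorem existsUnique_isGenericJordanType (K : Type*) [Field K] [Infinite K] (P : n.Partition) :
    ∃! Q : n.Partition, IsGenericJordanType K P Q := by
  obtain ⟨c, hc⟩ := exists_forall_rank_eq_maxRank K P
  obtain ⟨Q, hQ⟩ := exists_hasJordanType _ (isNilpotent_triMatrix (P := P) c)
    ((Fintype.card_coe _).trans (card_vertices P))
  refine ⟨Q, (isGenericJordanType_iff Q).2 fun i => by rw [← hQ.rank_pow, hc], ?_⟩
  intro Q' hQ'
  refine partition_ext_of_sum_tsub fun i => ?_
  rw [(isGenericJordanType_iff Q').1 hQ', ← hQ.rank_pow, hc]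

theorem sum_tsub_genericJordanType (K : Type*) [Field K] [Infinite K] (P : n.Partition) (i : ℕ) :
    ((genericJordanType K P).parts.map fun q => q - i).sum = maxRank K P i :=
  (isGenericJordanType_iff _).1
    (Classical.epsilon_spec (existsUnique_isGenericJordanType K P).exists) i

theorem sum_part_genericJordanType_le (K L : Type*) [Field K] [Infinite K] [Field L] [CharZero L]
    (P : n.Partition) (k : ℕ) :
    ∑ j ∈ Finset.Icc 1 k, part (genericJordanType K P) j ≤
      ∑ j ∈ Finset.Icc 1 k, part (genericJordanType L P) j := by
  have : Infinite L := Infinite.of_injective _ (Nat.cast_injective (R := L))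
  obtain ⟨i, hi⟩ := exists_sum_part_eq (genericJordanType L P) k
  have h1 := sum_part_le (genericJordanType K P) k i
  rw [sum_tsub_genericJordanType] at hi h1
  have := maxRank_le_maxRank_of_charZero K L P i
  omega

end

/-! ### Degeneration to a union of chains -/

/-- The span of the vectors `A ^ p x_j`, with `k` vectors `x_j`, has dimension at most
`k * i + rank (A ^ i)`. -/
theorem card_le_of_linearIndependent {K m T : Type*} [Field K] [Fintype m] [DecidableEq m]
    [Fintype T] {k : ℕ} (A : Matrix m m K) (x : Fin k → m → K) (j : T → Fin k) (p : T → ℕ)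
    (h : LinearIndependent K fun w => (A ^ p w).mulVec (x (j w))) (i : ℕ) :
    Fintype.card T ≤ k * i + (A ^ i).rank := by
  have h1 : Submodule.span K (Set.range fun w => (A ^ p w).mulVec (x (j w))) ≤
      Submodule.span K (Set.range fun y : Fin k × Fin i => (A ^ (y.2 : ℕ)).mulVec (x y.1)) ⊔
        LinearMap.range (A ^ i).mulVecLin := by
    rw [Submodule.span_le]
    rintro _ ⟨w, rfl⟩
    by_cases hp : p w < i
    · exact Submodule.mem_sup_left (Submodule.subset_span ⟨(j w, ⟨p w, hp⟩), rfl⟩)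
    · refine Submodule.mem_sup_right ⟨(A ^ (p w - i)).mulVec (x (j w)), ?_⟩
      rw [Matrix.mulVecLin_apply, Matrix.mulVec_mulVec, ← pow_add, Nat.add_sub_cancel' (by omega)]
  have h2 := Submodule.finrank_mono h1
  rw [finrank_span_eq_card h] at h2
  have h3 := Submodule.finrank_add_le_finrank_add_finrank
    (Submodule.span K (Set.range fun y : Fin k × Fin i => (A ^ (y.2 : ℕ)).mulVec (x y.1)))
    (LinearMap.range (A ^ i).mulVecLin)
  have h4 := finrank_range_le_card (R := K)
    (b := fun y : Fin k × Fin i => (A ^ (y.2 : ℕ)).mulVec (x y.1))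
  rw [Fintype.card_prod, Fintype.card_fin, Fintype.card_fin] at h4
  have h5 : (A ^ i).rank = Module.finrank K (LinearMap.range (A ^ i).mulVecLin) := rfl
  unfold Set.finrank at h4
  omega

open Polynomial in
/-- If the matrix `N(0)` maps certain basis vectors along `k` disjoint chains which cover `U`, then
for some `t ≠ 0` the rank of the powers of `N(t)` is at least what it would be if `N(t)` had Jordan
chains through all of `U`. -/
theorem exists_eval_card_le {K m : Type*} [Field K] [Infinite K] [Fintype m] [DecidableEq m]
    (N : Matrix m m K[X]) (U : Finset m) (key : m → ℕ) {k : ℕ} (start : Fin k → m)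
    (h : ∀ w ∈ U, (∃ j, start j = w) ∨
      ∃ v ∈ U, key v < key w ∧ ∀ x, (N x v).eval 0 = if x = w then 1 else 0) :
    ∃ t : K, t ≠ 0 ∧ ∀ i, U.card ≤ k * i + ((N.map (eval t)) ^ i).rank := by
  have hchain : ∀ (d : ℕ) (w : m), w ∈ U → key w < d →
      ∃ (j : Fin k) (p : ℕ), ∀ x, ((N ^ p) x (start j)).eval 0 = if x = w then 1 else 0 := by
    intro d
    induction d with
    | zero =>
      intro w _ hd
      omega
    | succ d ih =>
      intro w hw hd
      rcases h w hw with ⟨j, rfl⟩ | ⟨v, hv, hvw, hN⟩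
      · refine ⟨j, 0, fun x => ?_⟩
        rw [pow_zero, Matrix.one_apply]
        split_ifs <;> simp
      · obtain ⟨j, p, hp⟩ := ih v hv (by omega)
        refine ⟨j, p + 1, fun x => ?_⟩
        rw [pow_succ', Matrix.mul_apply, eval_finsetSum, Finset.sum_eq_single v, eval_mul, hp,
          if_pos rfl, mul_one, hN]
        · intro y _ hy
          rw [eval_mul, hp, if_neg hy, mul_zero]
        · simp
  choose j p hjp using fun w : U => hchain (key w + 1) w.1 w.2 (Nat.lt_succ_self _)
  let W : Matrix U U K[X] := Matrix.of fun x w => (N ^ p w) x (start (j w))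
  have hW0 : eval 0 W.det = 1 := by
    have : (evalRingHom (0 : K)).mapMatrix W = 1 := by
      ext x w
      simp only [W, RingHom.mapMatrix_apply, Matrix.map_apply, Matrix.of_apply, coe_evalRingHom,
        Matrix.one_apply, hjp w, Subtype.ext_iff]
    rw [← coe_evalRingHom, RingHom.map_det, this, Matrix.det_one]
  obtain ⟨t, ht⟩ : ∃ t, eval t (X * W.det) ≠ 0 := by
    by_contra! hcon
    have h0 : X * W.det = 0 := Polynomial.funext fun t => by rw [hcon, eval_zero]
    rcases mul_eq_zero.1 h0 with h0 | h0
    · exact X_ne_zero h0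
    · rw [h0, eval_zero] at hW0
      exact zero_ne_one hW0
  rw [eval_mul, eval_X] at ht
  refine ⟨t, left_ne_zero_of_mul ht, fun i => ?_⟩
  have hpow : ∀ q, (N.map (eval t)) ^ q = (N ^ q).map (eval t) := fun q =>
    (map_pow (evalRingHom t).mapMatrix N q).symm
  have hli : LinearIndependent K ((evalRingHom t).mapMatrix W).col := by
    rw [Matrix.linearIndependent_cols_iff_isUnit, Matrix.isUnit_iff_isUnit_det,
      ← RingHom.map_det, isUnit_iff_ne_zero]
    exact right_ne_zero_of_mul ht
  have hli' : LinearIndependent K fun w : U =>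
      ((N.map (eval t)) ^ p w).mulVec (Pi.single (start (j w)) 1) := by
    refine LinearIndependent.of_comp (LinearMap.funLeft K K (Subtype.val : U → m)) ?_
    convert hli using 1
    funext w x
    simp only [Function.comp_apply, LinearMap.funLeft_apply, Matrix.mulVec_single_one, hpow]
    rfl
  have := card_le_of_linearIndependent _ (fun l => Pi.single (start l) 1)
    j p hli' i
  rwa [Fintype.card_coe] at this

/-- Degeneration to a disjoint union of chains. The matrix `triMatrix P c` with coefficients
`t ^ wt` on a set `edge` of coefficients is conjugate, by the diagonal matrix `t ^ φ`, to a matrix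
with entries `t ^ (wt + φ v - φ w)`. If these exponents are nonnegative, one can put `t = 0` in the
latter matrix, and only the coefficients with exponent `0` survive. -/
theorem exists_triMatrix_card_le (K : Type*) [Field K] [Infinite K] {n : ℕ} (P : n.Partition)
    (edge : CoeffIndex → Prop) (wt : CoeffIndex → ℕ) (φ : vertices P → ℕ)
    (U : Finset (vertices P)) {k : ℕ} (start : Fin k → vertices P)
    (hφ : ∀ v w : vertices P, TriStep v.1 w.1 → edge (v.1.2, w.1.2, w.1.1 - v.1.1) →
      φ w ≤ wt (v.1.2, w.1.2, w.1.1 - v.1.1) + φ v)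
    (hU : ∀ w ∈ U, (∃ j, start j = w) ∨ ∃ v ∈ U, TriStep v.1 w.1 ∧
      edge (v.1.2, w.1.2, w.1.1 - v.1.1) ∧ wt (v.1.2, w.1.2, w.1.1 - v.1.1) + φ v = φ w ∧
      ∀ x : vertices P, x ≠ w → TriStep v.1 x.1 → edge (v.1.2, x.1.2, x.1.1 - v.1.1) →
        φ x < wt (v.1.2, x.1.2, x.1.1 - v.1.1) + φ v) :
    ∃ c : CoeffIndex → K, ∀ i, U.card ≤ k * i + (triMatrix P c ^ i).rank := by
  classical
  let N : Matrix (vertices P) (vertices P) (Polynomial K) := Matrix.of fun w v =>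
    if TriStep v.1 w.1 ∧ edge (v.1.2, w.1.2, w.1.1 - v.1.1) then
      Polynomial.X ^ (wt (v.1.2, w.1.2, w.1.1 - v.1.1) + φ v - φ w) else 0
  obtain ⟨t, ht, hcard⟩ := exists_eval_card_le N U (height P) start (by
    intro w hw
    rcases hU w hw with h | ⟨v, hv, h1, h2, h3, h4⟩
    · exact Or.inl h
    · refine Or.inr ⟨v, hv, height_lt_of_triStep h1, fun x => ?_⟩
      by_cases hx : x = w
      · subst hx
        simp only [N, Matrix.of_apply, if_pos (And.intro h1 h2), h3, Nat.sub_self, pow_zero,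
          Polynomial.eval_one, if_true]
      · rw [if_neg hx]
        simp only [N, Matrix.of_apply]
        split_ifs with h5
        · have := h4 x hx h5.1 h5.2
          rw [Polynomial.eval_pow, Polynomial.eval_X, zero_pow]
          omega
        · exact Polynomial.eval_zero)
  refine ⟨fun x => if edge x then t ^ wt x else 0, fun i => (hcard i).trans ?_⟩
  let g : Matrix (vertices P) (vertices P) K := Matrix.diagonal fun v => t ^ φ v
  let g' : Matrix (vertices P) (vertices P) K := Matrix.diagonal fun v => (t ^ φ v)⁻¹
  have hgg' : g * g' = 1 := by
    simp only [g, g', Matrix.diagonal_mul_diagonal]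
    rw [← Matrix.diagonal_one]
    congr 1
    funext v
    exact mul_inv_cancel₀ (pow_ne_zero _ ht)
  have hg'g : g' * g = 1 := by
    simp only [g, g', Matrix.diagonal_mul_diagonal]
    rw [← Matrix.diagonal_one]
    congr 1
    funext v
    exact inv_mul_cancel₀ (pow_ne_zero _ ht)
  have hconj : triMatrix P (fun x => if edge x then t ^ wt x else 0) =
      g * N.map (Polynomial.eval t) * g' := by
    ext w v
    simp only [g, g', Matrix.mul_diagonal, Matrix.diagonal_mul, triMatrix, N, Matrix.of_apply,
      Matrix.map_apply]
    by_cases h1 : TriStep v.1 w.1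
    · by_cases h2 : edge (v.1.2, w.1.2, w.1.1 - v.1.1)
      · have h3 := hφ v w h1 h2
        rw [if_pos h1, if_pos h2, if_pos ⟨h1, h2⟩, Polynomial.eval_pow, Polynomial.eval_X,
          ← pow_add, Nat.add_sub_cancel' h3, pow_add, mul_assoc,
          mul_inv_cancel₀ (pow_ne_zero _ ht), mul_one]
      · rw [if_pos h1, if_neg h2, if_neg fun h => h2 h.2]
        simp
    · rw [if_neg h1, if_neg fun h => h1 h.1]
      simp
  rw [hconj, conj_pow hgg' hg'g, rank_conj hgg' hg'g]

/-! ### The potential on the levels -/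

open Classical in
/-- The largest slope of the potential on the level `ℓ`. If `b c + 2 ≤ b (c + 1)`, it is strictly
increasing in `ℓ`, except that it takes the same value on the levels `b_c - 1` and `b_c` if the
chain `c` moves back and forth between them. -/
noncomputable def maxSlope (b : ℕ → ℕ) (ℓ : ℕ) : ℕ :=
  if ∃ c, b c = ℓ + 1 ∧ 2 * c < ℓ then 2 * ℓ + 2 else 2 * ℓ

/-- The slope of the potential on the level `ℓ` at distance `x` from the nearer end. -/
noncomputable def slope (b : ℕ → ℕ) (x ℓ : ℕ) : ℕ := min (maxSlope b ℓ) (2 * b x - 1)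

/-- The potential at the `u`-th position of the level `ℓ`. -/
noncomputable def potential (b : ℕ → ℕ) (u ℓ : ℕ) : ℕ :=
  ∑ x ∈ Finset.range u, slope b (min x (ℓ - x)) ℓ

theorem potential_succ (b : ℕ → ℕ) (u ℓ : ℕ) :
    potential b (u + 1) ℓ = potential b u ℓ + slope b (min u (ℓ - u)) ℓ :=
  Finset.sum_range_succ _ _

/-- The potential is symmetric under reversal of the level. -/
theorem potential_add_potential (b : ℕ → ℕ) {u ℓ : ℕ} (hu : u ≤ ℓ + 1) :
    potential b u ℓ + potential b (ℓ + 1 - u) ℓ = potential b (ℓ + 1) ℓ := by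
  have h : ∀ v, v ≤ ℓ + 1 → potential b (ℓ + 1) ℓ = potential b (ℓ + 1 - v) ℓ + potential b v ℓ := by
    intro v
    induction v with
    | zero => simp [potential]
    | succ v ih =>
      intro hv
      have h1 := ih (by omega)
      have h2 := potential_succ b (ℓ + 1 - (v + 1)) ℓ
      rw [show ℓ + 1 - (v + 1) + 1 = ℓ + 1 - v by omega,
        show min (ℓ + 1 - (v + 1)) (ℓ - (ℓ + 1 - (v + 1))) = min v (ℓ - v) by omega] at h2
      have h3 := potential_succ b v ℓ
      omega
  have := h u hu
  omega

section
variable {b : ℕ → ℕ}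

theorem gap_le (hb : ∀ c, b c + 2 ≤ b (c + 1)) {c d : ℕ} (h : c ≤ d) :
    b c + 2 * (d - c) ≤ b d := by
  obtain ⟨e, rfl⟩ := Nat.exists_eq_add_of_le h
  induction e with
  | zero => simp
  | succ e ih =>
    have := ih (by omega)
    have := hb (c + e)
    rw [← add_assoc]
    omega

theorem two_mul_lt (hb : ∀ c, b c + 2 ≤ b (c + 1)) (hb0 : 1 ≤ b 0) (c : ℕ) : 2 * c < b c := by
  have := gap_le hb (Nat.zero_le c)
  omega

theorem lt_of_apply_lt (hb : ∀ c, b c + 2 ≤ b (c + 1)) {c d : ℕ} (h : b c < b d) : c < d := by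
  by_contra hcd
  have := gap_le hb (not_lt.1 hcd)
  omega

theorem maxSlope_cases (b : ℕ → ℕ) (ℓ : ℕ) :
    (maxSlope b ℓ = 2 * ℓ + 2 ∧ ∃ c, b c = ℓ + 1 ∧ 2 * c < ℓ) ∨
    (maxSlope b ℓ = 2 * ℓ ∧ ∀ c, b c = ℓ + 1 → ℓ ≤ 2 * c) := by
  unfold maxSlope
  split_ifs with h
  · exact Or.inl ⟨rfl, h⟩
  · push Not at h
    exact Or.inr ⟨rfl, h⟩

theorem maxSlope_bounds (b : ℕ → ℕ) (ℓ : ℕ) :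
    2 * ℓ ≤ maxSlope b ℓ ∧ maxSlope b ℓ ≤ 2 * ℓ + 2 := by
  rcases maxSlope_cases b ℓ with h | h <;> omega

/-- The level `b_c - 1` has the large slope only for the sake of the chain `c`. -/
theorem maxSlope_eq_of_apply (hb : ∀ c, b c + 2 ≤ b (c + 1)) {c ℓ : ℕ} (h : b c = ℓ) :
    maxSlope b ℓ = 2 * ℓ := by
  rcases maxSlope_cases b ℓ with ⟨-, d, hd, -⟩ | h'
  · have h1 := lt_of_apply_lt hb (show b c < b d by omega)
    have := gap_le hb (show c + 1 ≤ d from h1)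
    have := hb c
    omega
  · exact h'.1

theorem slope_le_slope (hb : ∀ c, b c + 2 ≤ b (c + 1)) {x y ℓ ℓ' : ℕ} (hxy : x ≤ y)
    (hℓ : ℓ < ℓ') : slope b x ℓ ≤ slope b y ℓ' := by
  have := maxSlope_bounds b ℓ
  have := maxSlope_bounds b ℓ'
  have := gap_le hb hxy
  unfold slope
  omega

theorem potential_le_potential (hb : ∀ c, b c + 2 ≤ b (c + 1)) (v : ℕ) {ℓ ℓ' : ℕ}
    (hℓ : ℓ < ℓ') : potential b v ℓ ≤ potential b v ℓ' :=
  Finset.sum_le_sum fun _ _ => slope_le_slope hb (by omega) hℓ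

theorem potential_lt_potential (hb : ∀ c, b c + 2 ≤ b (c + 1)) {v x ℓ ℓ' : ℕ} (hℓ : ℓ < ℓ')
    (hx : x < v) (h : slope b (min x (ℓ - x)) ℓ < slope b (min x (ℓ' - x)) ℓ') :
    potential b v ℓ < potential b v ℓ' :=
  Finset.sum_lt_sum (fun _ _ => slope_le_slope hb (by omega) hℓ)
    ⟨x, Finset.mem_range.2 hx, h⟩

/-- On the left part of chain `c` the moves down do not change the potential. -/
theorem potential_eq_of_le (hb : ∀ c, b c + 2 ≤ b (c + 1)) (hb0 : 1 ≤ b 0) {c ℓ ℓ' : ℕ}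
    (hc : b c ≤ ℓ) (hℓ : ℓ < ℓ') : potential b (c + 1) ℓ = potential b (c + 1) ℓ' := by
  refine Finset.sum_congr rfl fun x hx => ?_
  have hx := Finset.mem_range.1 hx
  have h1 := two_mul_lt hb hb0 c
  have h2 := gap_le hb (show x ≤ c by omega)
  have h3 := maxSlope_bounds b ℓ
  have h4 := maxSlope_bounds b ℓ'
  rw [show min x (ℓ - x) = x by omega, show min x (ℓ' - x) = x by omega]
  unfold slope
  omega

/-- On the middle part of chain `c` the levels `b_c` and `b_c - 1` have the same potential. -/
theorem potential_eq_of_pair (hb : ∀ c, b c + 2 ≤ b (c + 1)) {c ℓ v : ℕ}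
    (hc : b c = ℓ + 1) (h1 : c + 1 ≤ v) (h2 : v ≤ ℓ - c) :
    potential b v ℓ = potential b v (ℓ + 1) := by
  have hs' := maxSlope_eq_of_apply hb hc
  have hs : maxSlope b ℓ = 2 * ℓ + 2 := by
    rcases maxSlope_cases b ℓ with h | h
    · exact h.1
    · have := h.2 c hc
      omega
  refine Finset.sum_congr rfl fun x hx => ?_
  have hx := Finset.mem_range.1 hx
  by_cases h : min x (ℓ - x) = min x (ℓ + 1 - x)
  · rw [h]
    unfold slope
    omega
  · have h3 := hb c
    have h4 := gap_le hb (show c + 1 ≤ min x (ℓ - x) by omega)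
    have h5 := gap_le hb (show c + 1 ≤ min x (ℓ + 1 - x) by omega)
    unfold slope
    omega

theorem slope_le_of_apply (hb : ∀ c, b c + 2 ≤ b (c + 1)) {c ℓ : ℕ} (hc : b c = ℓ) (x : ℕ) :
    slope b x ℓ ≤ 2 * ℓ := by
  have := maxSlope_eq_of_apply hb hc
  unfold slope
  omega

theorem slope_lt_of_apply (hb : ∀ c, b c + 2 ≤ b (c + 1)) (hb0 : 1 ≤ b 0) {c ℓ x : ℕ}
    (hc : b c = ℓ) (hx : x ≤ c) : slope b x ℓ < 2 * ℓ := by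
  have := gap_le hb hx
  have := two_mul_lt hb hb0 c
  unfold slope
  omega

theorem slope_eq_of_apply (hb : ∀ c, b c + 2 ≤ b (c + 1)) {c ℓ x : ℕ}
    (hc : b c = ℓ) (hx : c < x) : slope b x ℓ = 2 * ℓ := by
  have := maxSlope_eq_of_apply hb hc
  have := gap_le hb (show c + 1 ≤ x from hx)
  have := hb c
  unfold slope
  omega

/-- Between `c + 2` and `b_c - c`, the level `b_c` is strictly below the higher levels. -/
theorem potential_lt_above (hb : ∀ c, b c + 2 ≤ b (c + 1)) {c ℓ ℓ' v : ℕ} (hc : b c = ℓ)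
    (hℓ : ℓ < ℓ') (h1 : c + 2 ≤ v) (h2 : v ≤ ℓ - c) : potential b v ℓ < potential b v ℓ' := by
  refine potential_lt_potential hb hℓ (x := c + 1) (by omega) ?_
  rw [show min (c + 1) (ℓ - (c + 1)) = c + 1 by omega,
    show min (c + 1) (ℓ' - (c + 1)) = c + 1 by omega, slope_eq_of_apply hb hc (Nat.lt_succ_self c)]
  have := maxSlope_bounds b ℓ'
  have := hb c
  unfold slope
  omega

/-- At `u = c + 1`, whose mirrored position is `ℓ - c`, moving up from a level `ℓ > b_c` has a positive
exponent. -/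
theorem potential_lt_left_end (hb : ∀ c, b c + 2 ≤ b (c + 1)) (hb0 : 1 ≤ b 0) {c ℓ ℓ' : ℕ}
    (hc : b c < ℓ) (hℓ : ℓ < ℓ') : potential b (ℓ - c) ℓ < potential b (ℓ - c) ℓ' := by
  have h1 := two_mul_lt hb hb0 c
  refine potential_lt_potential hb hℓ (x := ℓ - c - 1) (by omega) ?_
  rw [show min (ℓ - c - 1) (ℓ - (ℓ - c - 1)) = c + 1 by omega]
  have h2 := maxSlope_bounds b ℓ'
  have h3 := hb c
  have h4 := hb (c + 1)
  have h5 := gap_le hb (show c + 1 ≤ min (ℓ - c - 1) (ℓ' - (ℓ - c - 1)) by omega)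
  have h6 : 2 * c + 3 ≤ ℓ → b (c + 2) ≤ b (min (ℓ - c - 1) (ℓ' - (ℓ - c - 1))) := by
    intro h
    have := gap_le hb (show c + 2 ≤ min (ℓ - c - 1) (ℓ' - (ℓ - c - 1)) by omega)
    omega
  rw [show c + 1 + 1 = c + 2 from rfl] at h4
  unfold slope
  rcases maxSlope_cases b ℓ with ⟨h7, d, hd, hd'⟩ | h7
  · have h8 := lt_of_apply_lt hb (show b c < b d by omega)
    have h9 := gap_le hb (show c + 1 ≤ d by omega)
    omega
  · omega

/-- On the right part `u = ℓ' - c` of chain `c`, moving down has a positive exponent. -/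
theorem potential_lt_right_end (hb : ∀ c, b c + 2 ≤ b (c + 1)) (hb0 : 1 ≤ b 0) {c ℓ ℓ' : ℕ}
    (hc : b c ≤ ℓ') (hℓ : ℓ < ℓ') :
    potential b (ℓ' - c) ℓ < potential b (ℓ' - c) ℓ' := by
  have h1 := two_mul_lt hb hb0 c
  refine potential_lt_potential hb hℓ (x := ℓ' - c - 1) (by omega) ?_
  have h2 := maxSlope_bounds b ℓ'
  have h3 := hb c
  have h4 := gap_le hb (show min (ℓ' - c - 1) (ℓ - (ℓ' - c - 1)) ≤ c by omega)
  have h5 := maxSlope_bounds b ℓ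
  unfold slope
  by_cases h6 : ℓ' = 2 * c + 1
  · rw [show min (ℓ' - c - 1) (ℓ' - (ℓ' - c - 1)) = c by omega]
    rcases maxSlope_cases b ℓ with ⟨h7, d, hd, hd'⟩ | h7
    · have h8 : d ≤ c := by
        by_contra hlt
        have := gap_le hb (show c ≤ d by omega)
        omega
      have h9 := gap_le hb h8
      omega
    · omega
  · rw [show min (ℓ' - c - 1) (ℓ' - (ℓ' - c - 1)) = c + 1 by omega]
    omega

/-- On the middle part of chain `c`, moving down to a level below `b_c - 1` has a positive exponent. -/
theorem potential_lt_below (hb : ∀ c, b c + 2 ≤ b (c + 1)) {c ℓ ℓ' v : ℕ}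
    (hc : b c = ℓ' + 1 ∧ ℓ < ℓ' ∨ b c = ℓ' ∧ ℓ + 1 < ℓ') (h1 : c + 1 ≤ v)
    (h2 : v ≤ ℓ' - c) : potential b v ℓ < potential b v ℓ' := by
  refine potential_lt_potential hb (by omega) (x := c) (by omega) ?_
  rw [show min c (ℓ' - c) = c by omega]
  have h3 := maxSlope_bounds b ℓ
  rcases hc with ⟨hc, hℓ⟩ | ⟨hc, hℓ⟩
  · have hs : maxSlope b ℓ' = 2 * ℓ' + 2 := by
      rcases maxSlope_cases b ℓ' with h | h
      · exact h.1
      · have := h.2 c hc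
        omega
    unfold slope
    omega
  · have := maxSlope_bounds b ℓ'
    unfold slope
    omega

end

/-! ### The matrix that realizes the chains -/

/-- `ℓ'` is the smallest part of `P` larger than the part `ℓ`. -/
def NextLevel {n : ℕ} (P : n.Partition) (ℓ ℓ' : ℕ) : Prop :=
  ℓ ∈ P.parts ∧ ℓ' ∈ P.parts ∧ ℓ < ℓ' ∧ ∀ x ∈ P.parts, x ≤ ℓ ∨ ℓ' ≤ x

/-- The nonzero coefficients of the matrix that realizes the `U`-chains: `(u, i, k)` is mapped to
`(u, i, k + 1)` for `k < n_i`, and `(u, i, n_i)` to the first vertex in position `u` of the next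
lower level, to the first vertex in position `u + i' - i` of the next higher level `i'`, and, if `i`
is some `b_c` and `i - 1` is not a part, to `(u + 1, i, 1)`. -/
def ChainEdge {n : ℕ} (P : n.Partition) (b : ℕ → ℕ) (x : CoeffIndex) : Prop :=
  (x.2.1.1 = x.1.1 ∧ x.2.1.2 = x.1.2 + 1 ∧ x.2.2 = 0) ∨
  (x.1.2 = P.parts.count x.1.1 ∧ x.2.1.2 = 1 ∧
    ((NextLevel P x.2.1.1 x.1.1 ∧ x.2.2 = 0) ∨
      (NextLevel P x.1.1 x.2.1.1 ∧ x.2.2 = x.2.1.1 - x.1.1) ∨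
      (x.2.1.1 = x.1.1 ∧ x.2.2 = 1 ∧ (∃ c, b c = x.1.1) ∧ x.1.1 - 1 ∉ P.parts)))

/-- The exponents of the coefficients of that matrix. -/
noncomputable def chainWeight (b : ℕ → ℕ) (x : CoeffIndex) : ℕ :=
  if x.1.1 < x.2.1.1 then potential b (x.2.1.1 + 1) x.2.1.1 - potential b (x.1.1 + 1) x.1.1
  else if x.2.2 = 0 then 0 else 2 * x.1.1

section
variable {n : ℕ} {P : n.Partition} {b : ℕ → ℕ}

theorem exists_nextLevel_above {ℓ x : ℕ} (hℓ : ℓ ∈ P.parts) (hx : x ∈ P.parts) (h : ℓ < x) :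
    ∃ ℓ', NextLevel P ℓ ℓ' := by
  classical
  have hne : (P.parts.toFinset.filter fun y => ℓ < y).Nonempty := ⟨x, by simp [hx, h]⟩
  have hm := Finset.min'_mem _ hne
  rw [Finset.mem_filter, Multiset.mem_toFinset] at hm
  refine ⟨_, hℓ, hm.1, hm.2, fun y hy => ?_⟩
  by_contra! hcon
  exact absurd (Finset.min'_le _ y (by simp [hy, hcon.1])) (not_le.2 hcon.2)

theorem exists_nextLevel_below {ℓ' x : ℕ} (hℓ : ℓ' ∈ P.parts) (hx : x ∈ P.parts) (h : x < ℓ') :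
    ∃ ℓ, NextLevel P ℓ ℓ' := by
  classical
  have hne : (P.parts.toFinset.filter fun y => y < ℓ').Nonempty := ⟨x, by simp [hx, h]⟩
  have hm := Finset.max'_mem _ hne
  rw [Finset.mem_filter, Multiset.mem_toFinset] at hm
  refine ⟨_, hm.1, hℓ, hm.2, fun y hy => ?_⟩
  by_contra! hcon
  exact absurd (Finset.le_max' _ y (by simp [hy, hcon.2])) (not_le.2 hcon.1)

theorem NextLevel.eq_left {ℓ₀ ℓ₁ ℓ : ℕ} (h₀ : NextLevel P ℓ₀ ℓ) (h₁ : NextLevel P ℓ₁ ℓ) :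
    ℓ₀ = ℓ₁ := by
  obtain ⟨a1, -, a3, a4⟩ := h₀
  obtain ⟨b1, -, b3, b4⟩ := h₁
  have := a4 _ b1
  have := b4 _ a1
  omega

theorem NextLevel.eq_right {ℓ₀ ℓ₁ ℓ : ℕ} (h₀ : NextLevel P ℓ ℓ₀) (h₁ : NextLevel P ℓ ℓ₁) :
    ℓ₀ = ℓ₁ := by
  obtain ⟨-, a2, a3, a4⟩ := h₀
  obtain ⟨-, b2, b3, b4⟩ := h₁
  have := a4 _ b2
  have := b4 _ a2
  omega

theorem potential_total_le (hb : ∀ c, b c + 2 ≤ b (c + 1)) {ℓ ℓ' : ℕ} (h : ℓ < ℓ') :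
    potential b (ℓ + 1) ℓ ≤ potential b (ℓ' + 1) ℓ' :=
  (potential_le_potential hb _ h).trans
    (Finset.sum_le_sum_of_subset (Finset.range_mono (by omega)))

/-- By the symmetry of the potential, the exponent of a coefficient leading to the next higher
level is a difference of potentials at the mirrored position. -/
theorem chainWeight_up (hb : ∀ c, b c + 2 ≤ b (c + 1)) {u ℓ k ℓ' k' d : ℕ} (hu : u ≤ ℓ)
    (h : ℓ < ℓ') :
    chainWeight b ((ℓ, k), (ℓ', k'), d) + potential b u ℓ + potential b (ℓ + 1 - u) ℓ =
      potential b (u + (ℓ' - ℓ)) ℓ' + potential b (ℓ + 1 - u) ℓ' := by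
  have h1 := potential_add_potential b (show u ≤ ℓ + 1 by omega)
  have h2 := potential_add_potential b (show u + (ℓ' - ℓ) ≤ ℓ' + 1 by omega)
  rw [show ℓ' + 1 - (u + (ℓ' - ℓ)) = ℓ + 1 - u by omega] at h2
  have h3 := potential_total_le hb h
  simp only [chainWeight, if_pos h]
  omega

theorem chainEdge_cases (hb : ∀ c, b c + 2 ≤ b (c + 1)) {v w : vertices P}
    (htri : TriStep v.1 w.1) (h : ChainEdge P b (v.1.2, w.1.2, w.1.1 - v.1.1)) :
    (w.1 = (v.1.1, v.1.2.1, v.1.2.2 + 1) ∧ chainWeight b (v.1.2, w.1.2, w.1.1 - v.1.1) = 0) ∨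
    (v.1.2.2 = P.parts.count v.1.2.1 ∧
      ((∃ ℓ, NextLevel P ℓ v.1.2.1 ∧ w.1 = (v.1.1, ℓ, 1) ∧
          chainWeight b (v.1.2, w.1.2, w.1.1 - v.1.1) = 0) ∨
        (∃ ℓ, NextLevel P v.1.2.1 ℓ ∧ w.1 = (v.1.1 + (ℓ - v.1.2.1), ℓ, 1) ∧
          chainWeight b (v.1.2, w.1.2, w.1.1 - v.1.1) + potential b v.1.1 v.1.2.1 +
            potential b (v.1.2.1 + 1 - v.1.1) v.1.2.1 =
          potential b w.1.1 ℓ + potential b (v.1.2.1 + 1 - v.1.1) ℓ) ∨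
        (w.1 = (v.1.1 + 1, v.1.2.1, 1) ∧ (∃ c, b c = v.1.2.1) ∧ v.1.2.1 - 1 ∉ P.parts ∧
          chainWeight b (v.1.2, w.1.2, w.1.1 - v.1.1) = 2 * v.1.2.1))) := by
  have hv := vertex_bounds v
  have hw := vertex_bounds w
  obtain ⟨⟨u, ℓ, k⟩, hvm⟩ := v
  obtain ⟨⟨u', ℓ', k'⟩, hwm⟩ := w
  simp only [ChainEdge, TriStep] at *
  rcases h with ⟨rfl, rfl, h⟩ | ⟨hk, rfl, ⟨hn, h⟩ | ⟨hn, h⟩ | ⟨rfl, h, hc, hP⟩⟩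
  · obtain rfl : u' = u := by omega
    exact Or.inl ⟨rfl, by simp [chainWeight]⟩
  · obtain rfl : u' = u := by omega
    exact Or.inr ⟨hk, Or.inl ⟨ℓ', hn, rfl, by simp [chainWeight, hn.2.2.1.le]⟩⟩
  · have hlt := hn.2.2.1
    obtain rfl : u' = u + (ℓ' - ℓ) := by omega
    exact Or.inr ⟨hk, Or.inr (Or.inl ⟨ℓ', hn, rfl, chainWeight_up hb hv.1.2 hlt⟩)⟩
  · obtain rfl : u' = u + 1 := by omega
    exact Or.inr ⟨hk, Or.inr (Or.inr ⟨rfl, hc, hP, by simp [chainWeight]⟩)⟩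

theorem potential_le_chainWeight (hb : ∀ c, b c + 2 ≤ b (c + 1)) {v w : vertices P}
    (htri : TriStep v.1 w.1) (h : ChainEdge P b (v.1.2, w.1.2, w.1.1 - v.1.1)) :
    potential b w.1.1 w.1.2.1 ≤
      chainWeight b (v.1.2, w.1.2, w.1.1 - v.1.1) + potential b v.1.1 v.1.2.1 := by
  rcases chainEdge_cases hb htri h with
    ⟨e, h0⟩ | ⟨-, ⟨ℓ, hn, e, h0⟩ | ⟨ℓ, hn, e, h0⟩ | ⟨e, ⟨c, hc⟩, -, h0⟩⟩
  · rw [e]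
    exact Nat.le_add_left _ _
  · have := potential_le_potential hb v.1.1 hn.2.2.1
    rw [h0, e, zero_add]
    exact this
  · have := potential_le_potential hb (v.1.2.1 + 1 - v.1.1) hn.2.2.1
    have e1 : w.1.2.1 = ℓ := by rw [e]
    rw [e1]
    omega
  · have := slope_le_of_apply hb hc (min v.1.1 (v.1.2.1 - v.1.1))
    rw [h0, e]
    simp only [potential_succ]
    omega

/-- A criterion for all exponents of the column of a vertex `(u, i, n_i)` except the one leading to
`w` to be positive. -/
theorem potential_lt_chainWeight (hb : ∀ c, b c + 2 ≤ b (c + 1)) {v : vertices P}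
    {w : ℕ × ℕ × ℕ} (hk : v.1.2.2 = P.parts.count v.1.2.1)
    (hdown : ∀ ℓ, NextLevel P ℓ v.1.2.1 → w = (v.1.1, ℓ, 1) ∨
      potential b v.1.1 ℓ < potential b v.1.1 v.1.2.1)
    (hup : ∀ ℓ, NextLevel P v.1.2.1 ℓ → w = (v.1.1 + (ℓ - v.1.2.1), ℓ, 1) ∨
      potential b (v.1.2.1 + 1 - v.1.1) v.1.2.1 < potential b (v.1.2.1 + 1 - v.1.1) ℓ)
    (hloop : ∀ c, b c = v.1.2.1 → v.1.2.1 - 1 ∉ P.parts → w = (v.1.1 + 1, v.1.2.1, 1) ∨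
      slope b (min v.1.1 (v.1.2.1 - v.1.1)) v.1.2.1 < 2 * v.1.2.1)
    (x : vertices P) (hx : x.1 ≠ w) (htri : TriStep v.1 x.1)
    (h : ChainEdge P b (v.1.2, x.1.2, x.1.1 - v.1.1)) :
    potential b x.1.1 x.1.2.1 <
      chainWeight b (v.1.2, x.1.2, x.1.1 - v.1.1) + potential b v.1.1 v.1.2.1 := by
  rcases chainEdge_cases hb htri h with
    ⟨e, h0⟩ | ⟨-, ⟨ℓ, hn, e, h0⟩ | ⟨ℓ, hn, e, h0⟩ | ⟨e, ⟨c, hc⟩, hP, h0⟩⟩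
  · have hxb := vertex_bounds x
    rw [e] at hxb
    simp only at hxb
    omega
  · have := (hdown ℓ hn).resolve_left fun h => hx (e.trans h.symm)
    rw [h0, e, zero_add]
    exact this
  · have := (hup ℓ hn).resolve_left fun h => hx (e.trans h.symm)
    have e1 : x.1.2.1 = ℓ := by rw [e]
    rw [e1]
    omega
  · have := (hloop c hc hP).resolve_left fun h => hx (e.trans h.symm)
    rw [h0, e]
    simp only [potential_succ]
    omega

/-- The position `(u, ℓ)` belongs to the union of the chains labelled by `b_0 < ⋯ < b_{s-1}`: the
chain `c` consists of the positions `(c + 1, ℓ)` and `(ℓ - c, ℓ)` on the levels `ℓ > b_c` and of the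
positions between `c + 1` and `ℓ - c` on the levels `b_c` and `b_c - 1`. -/
def InChains (b : ℕ → ℕ) (s u ℓ : ℕ) : Prop :=
  ∃ c < s, (ℓ = b c ∨ ℓ + 1 = b c) ∨ (b c < ℓ ∧ (u ≤ c + 1 ∨ ℓ ≤ u + c))

/-- `v` is the predecessor of `w` in a chain: the entry of `N(0)` from `v` to `w` is `1`, and it is
the only nonzero entry in the column of `v`. -/
def IsPred (b : ℕ → ℕ) (v w : vertices P) : Prop :=
  TriStep v.1 w.1 ∧ ChainEdge P b (v.1.2, w.1.2, w.1.1 - v.1.1) ∧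
    chainWeight b (v.1.2, w.1.2, w.1.1 - v.1.1) + potential b v.1.1 v.1.2.1 =
      potential b w.1.1 w.1.2.1 ∧
    ∀ x : vertices P, x ≠ w → TriStep v.1 x.1 → ChainEdge P b (v.1.2, x.1.2, x.1.1 - v.1.1) →
      potential b x.1.1 x.1.2.1 <
        chainWeight b (v.1.2, x.1.2, x.1.1 - v.1.1) + potential b v.1.1 v.1.2.1

theorem isPred_succ (hb : ∀ c, b c + 2 ≤ b (c + 1)) {u ℓ k : ℕ}
    (hv : (u, ℓ, k) ∈ vertices P) (hw : (u, ℓ, k + 1) ∈ vertices P) :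
    IsPred b (⟨_, hv⟩ : vertices P) ⟨_, hw⟩ := by
  have hw' := (mem_vertices _ _ _ _).1 hw
  refine ⟨⟨le_rfl, le_rfl, fun _ _ => Nat.lt_succ_self _⟩, Or.inl ⟨rfl, rfl, Nat.sub_self _⟩, ?_, ?_⟩
  · simp [chainWeight]
  · intro x hx htri h
    rcases chainEdge_cases hb htri h with ⟨e, -⟩ | ⟨e, -⟩
    · exact absurd (Subtype.ext e) hx
    · simp only at e
      omega

theorem isPred_down (hb : ∀ c, b c + 2 ≤ b (c + 1)) {u ℓ ℓ' : ℕ}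
    (hv : (u, ℓ', P.parts.count ℓ') ∈ vertices P) (hw : (u, ℓ, 1) ∈ vertices P)
    (hn : NextLevel P ℓ ℓ') (h0 : potential b u ℓ = potential b u ℓ')
    (hup : ∀ ℓ'', NextLevel P ℓ' ℓ'' →
      potential b (ℓ' + 1 - u) ℓ' < potential b (ℓ' + 1 - u) ℓ'')
    (hloop : ∀ c, b c = ℓ' → ℓ' - 1 ∉ P.parts → slope b (min u (ℓ' - u)) ℓ' < 2 * ℓ') :
    IsPred b (⟨_, hv⟩ : vertices P) ⟨_, hw⟩ := by
  have hlt := hn.2.2.1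
  refine ⟨⟨le_rfl, ?_, ?_⟩, Or.inr ⟨rfl, rfl, Or.inl ⟨hn, Nat.sub_self _⟩⟩, ?_, ?_⟩
  · simp only
    omega
  · simp only
    omega
  · simp [chainWeight, hlt.le, h0]
  · intro x hx
    refine potential_lt_chainWeight hb (w := (u, ℓ, 1)) rfl ?_ ?_ ?_ x
      fun h => hx (Subtype.ext h)
    · intro ℓ₀ hn₀
      rw [hn₀.eq_left hn]
      exact Or.inl rfl
    · exact fun ℓ'' h => Or.inr (hup ℓ'' h)
    · exact fun c hc h => Or.inr (hloop c hc h)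

theorem isPred_up (hb : ∀ c, b c + 2 ≤ b (c + 1)) {u u' ℓ ℓ' : ℕ}
    (hv : (u, ℓ, P.parts.count ℓ) ∈ vertices P) (hw : (u', ℓ', 1) ∈ vertices P)
    (hn : NextLevel P ℓ ℓ') (hu : u' = u + (ℓ' - ℓ))
    (h0 : potential b (ℓ + 1 - u) ℓ = potential b (ℓ + 1 - u) ℓ')
    (hdown : ∀ ℓ₀, NextLevel P ℓ₀ ℓ → potential b u ℓ₀ < potential b u ℓ)
    (hloop : ∀ c, b c = ℓ → ℓ - 1 ∉ P.parts → slope b (min u (ℓ - u)) ℓ < 2 * ℓ) :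
    IsPred b (⟨_, hv⟩ : vertices P) ⟨_, hw⟩ := by
  have hlt := hn.2.2.1
  have hv' := (mem_vertices _ _ _ _).1 hv
  subst hu
  refine ⟨⟨?_, ?_, ?_⟩, Or.inr ⟨rfl, rfl, Or.inr (Or.inl ⟨hn, ?_⟩)⟩, ?_, ?_⟩
  · simp only
    omega
  · simp only
    omega
  · simp only
    omega
  · simp only
    omega
  · have := chainWeight_up hb (k := P.parts.count ℓ) (k' := 1) (d := u + (ℓ' - ℓ) - u) hv'.1.2 hlt
    simp only
    omega
  · intro x hx
    refine potential_lt_chainWeight hb (w := (u + (ℓ' - ℓ), ℓ', 1)) rfl ?_ ?_ ?_ x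
      fun h => hx (Subtype.ext h)
    · exact fun ℓ₀ h => Or.inr (hdown ℓ₀ h)
    · intro ℓ₀ hn₀
      rw [hn₀.eq_right hn]
      exact Or.inl rfl
    · exact fun c hc h => Or.inr (hloop c hc h)

theorem isPred_loop (hb : ∀ c, b c + 2 ≤ b (c + 1)) {u ℓ c : ℕ}
    (hv : (u, ℓ, P.parts.count ℓ) ∈ vertices P) (hw : (u + 1, ℓ, 1) ∈ vertices P)
    (hc : b c = ℓ) (hℓ : ℓ - 1 ∉ P.parts)
    (h0 : slope b (min u (ℓ - u)) ℓ = 2 * ℓ)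
    (hdown : ∀ ℓ₀, NextLevel P ℓ₀ ℓ → potential b u ℓ₀ < potential b u ℓ)
    (hup : ∀ ℓ', NextLevel P ℓ ℓ' →
      potential b (ℓ + 1 - u) ℓ < potential b (ℓ + 1 - u) ℓ') :
    IsPred b (⟨_, hv⟩ : vertices P) ⟨_, hw⟩ := by
  refine ⟨⟨?_, ?_, ?_⟩, Or.inr ⟨rfl, rfl, Or.inr (Or.inr ⟨rfl, ?_, ⟨c, hc⟩, hℓ⟩)⟩, ?_, ?_⟩
  · simp only
    omega
  · simp only
    omega
  · simp only
    omega
  · simp only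
    omega
  · simp [chainWeight, potential_succ, h0, add_comm]
  · intro x hx
    refine potential_lt_chainWeight hb (w := (u + 1, ℓ, 1)) rfl ?_ ?_ ?_ x
      fun h => hx (Subtype.ext h)
    · exact fun ℓ₀ h => Or.inr (hdown ℓ₀ h)
    · exact fun ℓ' h => Or.inr (hup ℓ' h)
    · exact fun _ _ _ => Or.inl rfl

end

/-! ### Lower bound by the chains, and comparison of fields -/

section
variable {n : ℕ} {P : n.Partition} {b : ℕ → ℕ} {s : ℕ}

/-- Each vertex on the chains is the start of a chain or has a predecessor on the chains. -/
theorem exists_isPred (hb : ∀ c, b c + 2 ≤ b (c + 1)) (hb0 : 1 ≤ b 0)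
    (hP : ∀ c < s, b c ∈ P.parts) {u ℓ k : ℕ} (hw : (u, ℓ, k) ∈ vertices P)
    (hin : InChains b s u ℓ) :
    (∃ c < s, u = c + 1 ∧ k = 1 ∧ ∀ x ∈ P.parts, x ≤ ℓ) ∨
    ∃ v : vertices P, InChains b s v.1.1 v.1.2.1 ∧ IsPred b v ⟨_, hw⟩ := by
  have hw' := (mem_vertices _ _ _ _).1 hw
  have hℓ : ℓ ∈ P.parts := Multiset.count_pos.1 (by omega)
  have hlast : ∀ u ℓ, ℓ ∈ P.parts → 1 ≤ u → u ≤ ℓ → (u, ℓ, P.parts.count ℓ) ∈ vertices P := by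
    intro u ℓ h h1 h2
    have := Multiset.count_pos.2 h
    rw [mem_vertices]
    omega
  rcases Nat.lt_or_ge 1 k with hk | hk
  · obtain ⟨k, rfl⟩ : ∃ k', k = k' + 1 := ⟨k - 1, by omega⟩
    exact Or.inr ⟨⟨(u, ℓ, k), by rw [mem_vertices]; omega⟩, hin, isPred_succ hb _ hw⟩
  obtain rfl : k = 1 := by omega
  have hcases : ∃ c < s, (b c ≤ ℓ ∧ u = c + 1) ∨ (b c < ℓ ∧ u = ℓ - c) ∨
      (b c = ℓ ∧ c + 2 ≤ u ∧ u ≤ ℓ - c) ∨ (b c = ℓ + 1 ∧ c + 1 ≤ u ∧ u ≤ ℓ - c) := by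
    -- Positions outside the middle part of chain `c` lie on the left or right part of chain `d`.
    have hleft : ∀ c d, d ≤ c → c < s → u = d + 1 → b d ≤ ℓ → ∃ c < s,
        (b c ≤ ℓ ∧ u = c + 1) ∨ (b c < ℓ ∧ u = ℓ - c) ∨ (b c = ℓ ∧ c + 2 ≤ u ∧ u ≤ ℓ - c) ∨
        (b c = ℓ + 1 ∧ c + 1 ≤ u ∧ u ≤ ℓ - c) := fun c d h1 h2 h3 h4 =>
      ⟨d, by omega, Or.inl ⟨h4, h3⟩⟩
    have hright : ∀ c d, d ≤ c → c < s → u = ℓ - d → b d < ℓ → ∃ c < s,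
        (b c ≤ ℓ ∧ u = c + 1) ∨ (b c < ℓ ∧ u = ℓ - c) ∨ (b c = ℓ ∧ c + 2 ≤ u ∧ u ≤ ℓ - c) ∨
        (b c = ℓ + 1 ∧ c + 1 ≤ u ∧ u ≤ ℓ - c) := fun c d h1 h2 h3 h4 =>
      ⟨d, by omega, Or.inr (Or.inl ⟨h4, h3⟩)⟩
    obtain ⟨c, hc, (h | h) | ⟨h1, h2 | h2⟩⟩ := hin
    · rcases Nat.lt_or_ge u (c + 2) with h3 | h3
      · have := gap_le hb (show u - 1 ≤ c by omega)
        exact hleft c (u - 1) (by omega) hc (by omega) (by omega)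
      · rcases Nat.lt_or_ge (ℓ - c) u with h4 | h4
        · have := gap_le hb (show ℓ - u ≤ c by omega)
          exact hright c (ℓ - u) (by omega) hc (by omega) (by omega)
        · exact ⟨c, hc, Or.inr (Or.inr (Or.inl ⟨h.symm, h3, h4⟩))⟩
    · rcases Nat.lt_or_ge u (c + 1) with h3 | h3
      · have := gap_le hb (show u - 1 ≤ c by omega)
        exact hleft c (u - 1) (by omega) hc (by omega) (by omega)
      · rcases Nat.lt_or_ge (ℓ - c) u with h4 | h4
        · have := gap_le hb (show ℓ - u ≤ c by omega)
          exact hright c (ℓ - u) (by omega) hc (by omega) (by omega)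
        · exact ⟨c, hc, Or.inr (Or.inr (Or.inr ⟨h.symm, h3, h4⟩))⟩
    · have := gap_le hb (show u - 1 ≤ c by omega)
      exact hleft c (u - 1) (by omega) hc (by omega) (by omega)
    · have := gap_le hb (show ℓ - u ≤ c by omega)
      exact hright c (ℓ - u) (by omega) hc (by omega) (by omega)
  obtain ⟨c, hc, ⟨h1, rfl⟩ | ⟨h1, rfl⟩ | ⟨h1, h2, h3⟩ | ⟨h1, h2, h3⟩⟩ := hcases
  · by_cases hmax : ∀ x ∈ P.parts, x ≤ ℓ
    · exact Or.inl ⟨c, hc, rfl, rfl, hmax⟩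
    · push Not at hmax
      obtain ⟨x, hx, hlx⟩ := hmax
      obtain ⟨ℓ', hn⟩ := exists_nextLevel_above hℓ hx hlx
      have hlt := hn.2.2.1
      refine Or.inr ⟨⟨_, hlast (c + 1) ℓ' hn.2.1 (by omega) (by omega)⟩,
        ⟨c, hc, Or.inr ⟨by simp only; omega, Or.inl le_rfl⟩⟩,
        isPred_down hb _ hw hn (potential_eq_of_le hb hb0 h1 hlt) ?_ ?_⟩
      · intro ℓ'' hn'
        rw [show ℓ' + 1 - (c + 1) = ℓ' - c by omega]
        exact potential_lt_left_end hb hb0 (by omega) hn'.2.2.1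
      · intro d hd _
        have := lt_of_apply_lt hb (show b c < b d by omega)
        exact slope_lt_of_apply hb hb0 hd (by omega)
  · obtain ⟨ℓ₁, hn⟩ := exists_nextLevel_below hℓ (hP c hc) h1
    have hlt := hn.2.2.1
    have hle : b c ≤ ℓ₁ := (hn.2.2.2 _ (hP c hc)).resolve_right (by omega)
    have h2 := two_mul_lt hb hb0 c
    refine Or.inr ⟨⟨_, hlast (ℓ₁ - c) ℓ₁ hn.1 (by omega) (by omega)⟩, ⟨c, hc, ?_⟩,
      isPred_up hb _ hw hn (by omega) ?_ ?_ ?_⟩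
    · simp only
      omega
    · rw [show ℓ₁ + 1 - (ℓ₁ - c) = c + 1 by omega]
      exact potential_eq_of_le hb hb0 hle hlt
    · intro ℓ₀ hn'
      exact potential_lt_right_end hb hb0 hle hn'.2.2.1
    · intro d hd _
      have : c ≤ d := by
        by_contra hcd
        have := gap_le hb (show d ≤ c by omega)
        omega
      exact slope_lt_of_apply hb hb0 hd (by omega)
  · by_cases hp : ℓ - 1 ∈ P.parts
    · have hn : NextLevel P (ℓ - 1) ℓ := ⟨hp, hℓ, by omega, fun x _ => by omega⟩
      refine Or.inr ⟨⟨_, hlast (u - 1) (ℓ - 1) hp (by omega) (by omega)⟩,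
        ⟨c, hc, Or.inl (Or.inr (by simp only; omega))⟩, isPred_up hb _ hw hn (by omega) ?_ ?_ ?_⟩
      · have := potential_eq_of_pair hb (c := c) (ℓ := ℓ - 1) (v := ℓ - 1 + 1 - (u - 1))
          (by omega) (by omega) (by omega)
        rwa [show ℓ - 1 + 1 = ℓ by omega] at this ⊢
      · intro ℓ₀ hn'
        have hlt := hn'.2.2.1
        exact potential_lt_below hb (c := c) (Or.inl ⟨by omega, hlt⟩) (by omega) (by omega)
      · intro d hd _
        have h4 := lt_of_apply_lt hb (show b d < b c by omega)
        have := gap_le hb (show d + 1 ≤ c from h4)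
        have := hb d
        omega
    · refine Or.inr ⟨⟨_, hlast (u - 1) ℓ hℓ (by omega) (by omega)⟩,
        ⟨c, hc, Or.inl (Or.inl h1.symm)⟩, ?_⟩
      obtain ⟨u, rfl⟩ : ∃ u', u = u' + 1 := ⟨u - 1, by omega⟩
      refine isPred_loop hb _ hw h1 hp (slope_eq_of_apply hb h1 (by omega)) ?_ ?_
      · intro ℓ₀ hn'
        have hlt := hn'.2.2.1
        have hne : ℓ₀ ≠ ℓ - 1 := fun h => hp (h ▸ hn'.1)
        exact potential_lt_below hb (c := c) (Or.inr ⟨h1, by omega⟩) (by omega) (by omega)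
      · intro ℓ' hn'
        exact potential_lt_above hb h1 hn'.2.2.1 (by omega) (by omega)
  · have hp : ℓ + 1 ∈ P.parts := h1 ▸ hP c hc
    have hn : NextLevel P ℓ (ℓ + 1) := ⟨hℓ, hp, by omega, fun x _ => by omega⟩
    refine Or.inr ⟨⟨_, hlast u (ℓ + 1) hp (by omega) (by omega)⟩,
      ⟨c, hc, Or.inl (Or.inl h1.symm)⟩,
      isPred_down hb _ hw hn (potential_eq_of_pair hb h1 h2 h3) ?_ ?_⟩
    · intro ℓ'' hn'
      exact potential_lt_above hb h1 hn'.2.2.1 (by omega) (by omega)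
    · intro d hd hd'
      exact absurd hℓ hd'

theorem exists_triMatrix_card_inChains_le (K : Type*) [Field K] [Infinite K] (P : n.Partition)
    (hb : ∀ c, b c + 2 ≤ b (c + 1)) (hb0 : 1 ≤ b 0) (hP : ∀ c < s, b c ∈ P.parts)
    (U : Finset (ℕ × ℕ × ℕ)) (hU : ∀ v ∈ U, v ∈ vertices P ∧ InChains b s v.1 v.2.1) :
    ∃ c : CoeffIndex → K, ∀ i, U.card ≤ s * i + (triMatrix P c ^ i).rank := by
  classical
  let U' : Finset (vertices P) := Finset.univ.filter fun v => InChains b s v.1.1 v.1.2.1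
  have hcard : U.card ≤ U'.card := by
    rw [← Finset.card_map (Function.Embedding.subtype _)]
    refine Finset.card_le_card fun v hv => ?_
    obtain ⟨h1, h2⟩ := hU v hv
    rw [Finset.mem_map]
    exact ⟨⟨v, h1⟩, by simpa [U'] using h2, rfl⟩
  let L : ℕ := P.parts.toFinset.sup id
  have hL : ∀ x ∈ P.parts, x ≤ L := fun x hx =>
    Finset.le_sup (f := id) (Multiset.mem_toFinset.2 hx)
  have hstart : ∀ c : Fin s, ((c : ℕ) + 1, L, 1) ∈ vertices P := by
    intro c
    have hmem := hP c c.2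
    obtain ⟨x, hx, hxL⟩ := Finset.exists_mem_eq_sup P.parts.toFinset
      ⟨_, Multiset.mem_toFinset.2 hmem⟩ id
    have h1 : L ∈ P.parts := by
      rw [Multiset.mem_toFinset] at hx
      rwa [show L = x from hxL]
    have h2 := Multiset.count_pos.2 h1
    have h3 := hL _ hmem
    have h4 := two_mul_lt hb hb0 c
    rw [mem_vertices]
    omega
  obtain ⟨c, hc⟩ := exists_triMatrix_card_le K P (ChainEdge P b) (chainWeight b)
    (fun v => potential b v.1.1 v.1.2.1) U' (fun c => ⟨_, hstart c⟩)
    (fun v w h1 h2 => potential_le_chainWeight hb h1 h2) (by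
      rintro ⟨⟨u, ℓ, k⟩, hw⟩ hwU
      have hwU := (Finset.mem_filter.1 hwU).2
      have hw' := (mem_vertices _ _ _ _).1 hw
      rcases exists_isPred hb hb0 hP hw hwU with ⟨c, hc, rfl, rfl, hmax⟩ | ⟨v, hv, hvw⟩
      · left
        refine ⟨⟨c, hc⟩, Subtype.ext ?_⟩
        have hℓ : ℓ = L := le_antisymm (hL _ (Multiset.count_pos.1 (by omega)))
          (Finset.sup_le fun x hx => hmax x (Multiset.mem_toFinset.1 hx))
        change (c + 1, L, 1) = (c + 1, ℓ, 1)
        rw [hℓ]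
      · exact Or.inr ⟨v, Finset.mem_filter.2 ⟨Finset.mem_univ _, hv⟩, hvw⟩)
  exact ⟨c, fun i => hcard.trans (hc i)⟩

/-- For each `s`-`U`-chain some matrix in the nilpotent commutator has powers of rank as large as if the
`U`-chain were spanned by the images of `s` vectors under its powers. -/
theorem exists_triMatrix_card_uChain_le (K : Type*) [Field K] [Infinite K] (P : n.Partition)
    (a : Fin s → ℕ) (ha : IsUChainLabel P a) :
    ∃ c : CoeffIndex → K, ∀ i, (uChain P a).card ≤ s * i + (triMatrix P c ^ i).rank := by
  obtain ⟨hmem, hgap⟩ := ha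
  have hle : ∀ i, a i ≤ n := fun i => by
    have := Multiset.le_sum_of_mem (hmem i)
    rwa [P.parts_sum] at this
  -- The label in increasing order, continued by values beyond all levels, which spares a
  -- case distinction at the last chain.
  let b : ℕ → ℕ := fun c => if h : c < s then a (Fin.rev ⟨c, h⟩) else n + 2 + 2 * c
  have hbs : ∀ i : Fin s, b (Fin.rev i) = a i := by
    intro i
    have hi := (Fin.rev i).2
    simp only [b, dif_pos hi, Fin.eta, Fin.rev_rev]
  have hb : ∀ c, b c + 2 ≤ b (c + 1) := by
    intro c
    simp only [b]
    split_ifs with h1 h2 h2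
    · exact hgap _ _ (Fin.rev_lt_rev.2 (Nat.lt_succ_self c))
    · have := hle (Fin.rev ⟨c, h1⟩)
      omega
    · omega
    · omega
  have hb0 : 1 ≤ b 0 := by
    simp only [b]
    split_ifs with h
    · exact P.parts_pos (hmem _)
    · omega
  refine exists_triMatrix_card_inChains_le K P hb hb0 (s := s) ?_ _ ?_
  · intro c hc
    simp only [b, dif_pos hc]
    exact hmem _
  · rintro ⟨u, ℓ, k⟩ hv
    obtain ⟨hv, h⟩ := Finset.mem_filter.1 hv
    refine ⟨hv, ?_⟩
    simp only at h ⊢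
    have hv' := (mem_vertices _ _ _ _).1 hv
    rcases h with ⟨i, hi⟩ | ⟨-, -, h⟩
    · refine ⟨_, (Fin.rev i).2, Or.inl ?_⟩
      rwa [hbs]
    · -- The `m` indices with `b_c < ℓ` are `0, …, m - 1`.
      have key : ∀ c, c < (Finset.univ.filter fun i => a i < ℓ).card → c < s ∧ b c < ℓ := by
        intro c hc
        by_contra hcon
        have hsub : ((Finset.univ.filter fun i => a i < ℓ).map
            (⟨fun i : Fin s => (Fin.rev i : ℕ), fun i j hij =>
              Fin.rev_injective (Fin.ext hij)⟩ : Fin s ↪ ℕ)) ⊆ Finset.range c := by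
          intro x hx
          obtain ⟨i, hi, rfl⟩ := Finset.mem_map.1 hx
          have hi := (Finset.mem_filter.1 hi).2
          have hi' := (Fin.rev i).2
          rw [Finset.mem_range]
          by_contra hlt
          have hci : c ≤ (Fin.rev i : ℕ) := not_lt.1 hlt
          have h1 := gap_le hb hci
          rw [hbs] at h1
          exact hcon ⟨by omega, by omega⟩
        have h1 := Finset.card_le_card hsub
        rw [Finset.card_map, Finset.card_range] at h1
        omega
      rcases h with h | h
      · obtain ⟨h1, h2⟩ := key (u - 1) (by omega)
        exact ⟨u - 1, h1, Or.inr ⟨h2, Or.inl (by omega)⟩⟩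
      · obtain ⟨h1, h2⟩ := key (ℓ - u) (by omega)
        exact ⟨ℓ - u, h1, Or.inr ⟨h2, Or.inr (by omega)⟩⟩

theorem maxUChain_le (K : Type*) [Field K] [Infinite K] (P : n.Partition) (k : ℕ) :
    maxUChain P k ≤ ∑ j ∈ Finset.Icc 1 k, part (genericJordanType K P) j := by
  obtain ⟨i, hi⟩ := exists_sum_part_eq (genericJordanType K P) k
  rw [hi, sum_tsub_genericJordanType]
  refine csSup_le' ?_
  rintro _ ⟨a, ha, rfl⟩
  obtain ⟨c, hc⟩ := exists_triMatrix_card_uChain_le K P a ha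
  exact (hc i).trans (Nat.add_le_add_left (rank_triMatrix_le c i) _)

/-- There is one label with `s = 0`, and its chain is empty. -/
theorem maxUChain_zero (P : n.Partition) : maxUChain P 0 = 0 := by
  rw [← Nat.le_zero]
  refine csSup_le' ?_
  rintro _ ⟨a, -, rfl⟩
  simp [uChain]

theorem sum_lambdaU (P : n.Partition) (k : ℕ) :
    ∑ i ∈ Finset.Icc 1 k, lambdaU P i = maxUChain P k := by
  induction k with
  | zero => simp [maxUChain_zero]
  | succ k ih =>
    rw [Finset.sum_Icc_succ_top (by omega), ih, lambdaU, Nat.add_sub_cancel]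
    ring

end
end NilpComm

theorem corollary3p10 (K : Type*) [Field K] [Infinite K] {n : ℕ} (P : n.Partition)
    (k : ℕ) (hk : 1 ≤ k) (hkr : k ≤ NilpComm.arNumber P) :
    (∃! Q : n.Partition, NilpComm.IsGenericJordanType K P Q) ∧
    (∑ i ∈ Finset.Icc 1 k, (NilpComm.part (NilpComm.genericJordanType ℝ P) i : ℤ) =
        ∑ i ∈ Finset.Icc 1 k, NilpComm.lambdaU P i →
      ∑ i ∈ Finset.Icc 1 k, (NilpComm.part (NilpComm.genericJordanType K P) i : ℤ) =
        ∑ i ∈ Finset.Icc 1 k, NilpComm.lambdaU P i) := by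
  refine ⟨NilpComm.existsUnique_isGenericJordanType K P, fun h => ?_⟩
  have h1 := NilpComm.sum_part_genericJordanType_le K ℝ P k
  have h2 := NilpComm.maxUChain_le K P k
  rw [NilpComm.sum_lambdaU] at h ⊢
  rw [← Nat.cast_sum] at h ⊢
  norm_cast at h ⊢
  omega
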